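/- Let $\mathcal X_1,\mathcal X_2,\mathcal S,\mathcal Y_2,\mathcal Y_3$ be finite nonempty sets, $Q_S$ a probability distribution on $\mathcal S$, and $W_{Y_2,Y_3|X_1,X_2,S}$ a family of conditional probability distributions from $\mathcal X_1\times\mathcal X_2\times\mathcal S$ to $\mathcal Y_2\times\mathcal Y_3$ (a state-dependent discrete memoryless relay channel). The states $S^n$ are i.i.d. with law $Q_S$ and are known, non-causally, to the relay only: a code of block length $n$ with $M$ messages consists of a source encoder $\{1,\dots,M\}\to\mathcal X_1^n$, relay encoders $\mathcal S^n\times\mathcal Y_2^{i-1}\to\mathcal X_2$ ($i=1,\dots,n$), and a decoder $\mathcal Y_3^n\to\{1,\dots,M\}$. Given $S^n$, the inputs and the past outputs, the $i$-th output pair $(Y_{2,i},Y_{3,i})$ has law $W(\cdot\mid X_{1,i},X_{2,i},S_i)$. A rate $R$ is achievable if there are codes of block length $n=0,1,2,\dots$ with $M_n\ge e^{nR}$ messages whose average error probability (for a uniform message) tends to $0$; the capacity $C$ is the supremum of the achievable rates. Rates and mutual informations are measured in nats. Then \[ C\ \le\ R^{\mathrm{out}}=\max\min\bigl\{I(X_1;Y_2,Y_3|S,X_2),\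 I(X_1,X_2;Y_3|S)-I(X_1;S|Y_3)\bigr\}, \] where the maximum is over all joint distributions of the form $Q_S\,P_{X_1}\,P_{X_2|X_1,S}\,W_{Y_2,Y_3|X_1,X_2,S}$ and is attained. Moreover this bound is tighter than the trivial bound, for which the state is available to the source and the destination as well, \[ R^{\mathrm{out}}_{\mathrm{triv}}=\max\min\bigl\{I(X_1;Y_2,Y_3|S,X_2),\ I(X_1,X_2;Y_3|S)\bigr\}, \] where the maximum is over all joint distributions of the form $Q_S\,P_{X_1|S}\,P_{X_2|X_1,S}\,W_{Y_2,Y_3|X_1,X_2,S}$ and is attained: $R^{\mathrm{out}}\le R^{\mathrm{out}}_{\mathrm{triv}}$ for every such channel, and $R^{\mathrm{out}}<R^{\mathrm{out}}_{\mathrm{triv}}$ for some channel with binary alphabets. -/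

import Mathlib

/-- The marginal law of the random variable `f` under the mass function `P` on a finite set. -/
noncomputable def marginal {Ω α : Type*} [Fintype Ω] (P : Ω → ℝ) (f : Ω → α) (a : α) : ℝ :=
  ∑ ω, (f ⁻¹' {a}).indicator P ω

/-- The conditional mutual information `I(A;B|C)` (in nats) of the finite-valued random variables
`A`, `B`, `C` under `P`:
`∑ p(a,b,c) log (p(a,b,c) p(c) / (p(a,c) p(b,c)))`. Terms with `p(a,b,c) = 0` contribute `0`. -/
noncomputable def condMutualInfo {Ω α β γ : Type*} [Fintype Ω] [Fintype α] [Fintype β] [Fintype γ]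
    (P : Ω → ℝ) (A : Ω → α) (B : Ω → β) (C : Ω → γ) : ℝ :=
  ∑ a, ∑ b, ∑ c,
    marginal P (fun ω => (A ω, B ω, C ω)) (a, b, c) *
      Real.log
        (marginal P (fun ω => (A ω, B ω, C ω)) (a, b, c) * marginal P C c /
          (marginal P (fun ω => (A ω, C ω)) (a, c) * marginal P (fun ω => (B ω, C ω)) (b, c)))

/-- A state-dependent discrete memoryless relay channel: `Q` is the law of the state and
`W x₁ x₂ s` is the conditional law of the pair (relay output, destination output) given the source
input `x₁`, the relay input `x₂` and the state `s`. -/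
structure RelayChannel (X₁ X₂ S Y₂ Y₃ : Type*) [Fintype S] [Fintype Y₂] [Fintype Y₃] where
  Q : S → ℝ
  Q_mem : Q ∈ stdSimplex ℝ S
  W : X₁ → X₂ → S → Y₂ × Y₃ → ℝ
  W_mem : ∀ x₁ x₂ s, W x₁ x₂ s ∈ stdSimplex ℝ (Y₂ × Y₃)

/-- A code of block length `n` with `M` messages when only the relay is informed of the state. The
source maps the message to `x₁ⁿ`; at time `i` the relay uses the whole state sequence
(non-causally) and its own strictly past outputs; the destination sees only `y₃ⁿ`. -/
structure RelayCode (X₁ X₂ S Y₂ Y₃ : Type*) (n M : ℕ) where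
  enc : Fin M → Fin n → X₁
  relay : (i : Fin n) → (Fin n → S) → (Fin i → Y₂) → X₂
  dec : (Fin n → Y₃) → Fin M

namespace RelayChannel

variable {X₁ X₂ S Y₂ Y₃ : Type*} [Fintype X₁] [Fintype X₂] [Fintype S] [Fintype Y₂] [Fintype Y₃]

/-- The probability, given the message `m`, of the i.i.d. state sequence `s` together with the
output sequence `y` (pairs of relay and destination outputs). -/
def blockLaw (C : RelayChannel X₁ X₂ S Y₂ Y₃) {n M : ℕ} (c : RelayCode X₁ X₂ S Y₂ Y₃ n M)
    (m : Fin M) (s : Fin n → S) (y : Fin n → Y₂ × Y₃) : ℝ :=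
  ∏ i : Fin n, C.Q (s i) *
    C.W (c.enc m i) (c.relay i s (fun j => (y (Fin.castLE i.isLt.le j)).1)) (s i) (y i)

/-- The average probability of error, the message being uniform on `Fin M`. -/
noncomputable def errorProb (C : RelayChannel X₁ X₂ S Y₂ Y₃) {n M : ℕ}
    (c : RelayCode X₁ X₂ S Y₂ Y₃ n M) : ℝ :=
  (M : ℝ)⁻¹ * ∑ m : Fin M, ∑ s : Fin n → S, ∑ y : Fin n → Y₂ × Y₃,
    if c.dec (fun i => (y i).2) = m then 0 else C.blockLaw c m s y

/-- The rate `R` (in nats per channel use) is achievable: some sequence of codes with at least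
`exp (n R)` messages has vanishing average probability of error. -/
def Achievable (C : RelayChannel X₁ X₂ S Y₂ Y₃) (R : ℝ) : Prop :=
  ∃ (M : ℕ → ℕ) (c : ∀ n, RelayCode X₁ X₂ S Y₂ Y₃ n (M n)),
    (∀ n : ℕ, Real.exp (n * R) ≤ M n) ∧
      Filter.Tendsto (fun n => C.errorProb (c n)) Filter.atTop (nhds 0)

/-- The capacity: the supremum of the achievable rates, taken in the extended reals. -/
noncomputable def capacity (C : RelayChannel X₁ X₂ S Y₂ Y₃) : EReal :=
  ⨆ (R : ℝ) (_ : C.Achievable R), (R : EReal)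

/-- The joint measures `Q_S P_{X₁} P_{X₂|X₁,S} W` on `(s, x₁, x₂, y₂, y₃)`. -/
def outerMeasures (C : RelayChannel X₁ X₂ S Y₂ Y₃) : Set (S × X₁ × X₂ × Y₂ × Y₃ → ℝ) :=
  {P | ∃ (p₁ : X₁ → ℝ) (p₂ : X₁ → S → X₂ → ℝ),
    p₁ ∈ stdSimplex ℝ X₁ ∧ (∀ x₁ s, p₂ x₁ s ∈ stdSimplex ℝ X₂) ∧
    P = fun (s, x₁, x₂, y) => C.Q s * p₁ x₁ * p₂ x₁ s x₂ * C.W x₁ x₂ s y}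

/-- The joint measures `Q_S P_{X₁|S} P_{X₂|X₁,S} W` on `(s, x₁, x₂, y₂, y₃)`. -/
def trivMeasures (C : RelayChannel X₁ X₂ S Y₂ Y₃) : Set (S × X₁ × X₂ × Y₂ × Y₃ → ℝ) :=
  {P | ∃ (p₁ : S → X₁ → ℝ) (p₂ : X₁ → S → X₂ → ℝ),
    (∀ s, p₁ s ∈ stdSimplex ℝ X₁) ∧ (∀ x₁ s, p₂ x₁ s ∈ stdSimplex ℝ X₂) ∧
    P = fun (s, x₁, x₂, y) => C.Q s * p₁ s x₁ * p₂ x₁ s x₂ * C.W x₁ x₂ s y}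

/-- `I(X₁; Y₂, Y₃ | S, X₂)` under `P`. -/
noncomputable def broadcastInfo (P : S × X₁ × X₂ × Y₂ × Y₃ → ℝ) : ℝ :=
  condMutualInfo P (fun (_, x₁, _, _, _) => x₁) (fun (_, _, _, y₂, y₃) => (y₂, y₃))
    (fun (s, _, x₂, _, _) => (s, x₂))

/-- `I(X₁, X₂; Y₃ | S)` under `P`. -/
noncomputable def accessInfo (P : S × X₁ × X₂ × Y₂ × Y₃ → ℝ) : ℝ :=
  condMutualInfo P (fun (_, x₁, x₂, _, _) => (x₁, x₂)) (fun (_, _, _, _, y₃) => y₃)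
    (fun (s, _, _, _, _) => s)

/-- `I(X₁; S | Y₃)` under `P`. -/
noncomputable def penaltyInfo (P : S × X₁ × X₂ × Y₂ × Y₃ → ℝ) : ℝ :=
  condMutualInfo P (fun (_, x₁, _, _, _) => x₁) (fun (s, _, _, _, _) => s)
    (fun (_, _, _, _, y₃) => y₃)

/-- The values of `min {I(X₁;Y₂,Y₃|S,X₂), I(X₁,X₂;Y₃|S) - I(X₁;S|Y₃)}` over `outerMeasures`. -/
def outerValues (C : RelayChannel X₁ X₂ S Y₂ Y₃) : Set ℝ :=
  (fun P => min (broadcastInfo P) (accessInfo P - penaltyInfo P)) '' C.outerMeasures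

/-- The values of `min {I(X₁;Y₂,Y₃|S,X₂), I(X₁,X₂;Y₃|S)}` over `trivMeasures`. -/
def trivValues (C : RelayChannel X₁ X₂ S Y₂ Y₃) : Set ℝ :=
  (fun P => min (broadcastInfo P) (accessInfo P)) '' C.trivMeasures

/-- The upper bound `R^out`. -/
noncomputable def Rout (C : RelayChannel X₁ X₂ S Y₂ Y₃) : ℝ := sSup C.outerValues

/-- The trivial upper bound `R^out_triv`. -/
noncomputable def Rtriv (C : RelayChannel X₁ X₂ S Y₂ Y₃) : ℝ := sSup C.trivValues

end RelayChannel

/-! ### Entropy calculus for mass functions on a finite set. -/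

section Entropy

variable {Ω α β γ ζ : Type*} [Fintype Ω]

/-! Write the second term as `H(Y₃) - H(Y₃|S,X₁,X₂) + H(S|X₁,Y₃) - H(S)`. For a code with message
`m`, independence of `m` and `Sⁿ` gives the block identity `I(m;Y₃ⁿ) = H(Y₃ⁿ) - H(Y₃ⁿ|m,Sⁿ) +
H(Sⁿ|m,Y₃ⁿ) - H(Sⁿ)`, which single-letterizes term by term: chain rule, conditioning reduces
entropy, i.i.d. states, and the fact that the channel sees the past only through the current
letters. The first term bounds `I(m;Y₃ⁿ) ≤ I(m;Yⁿ|Sⁿ)` similarly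
(`messageInfo_le_sum_accessInfo_sub`, `messageInfo_le_sum_broadcastInfo`).

No time-sharing variable is needed. The source is uninformed, so `X₁` is independent of the state at
each time, a condition linear in the law once `Q` is fixed. Hence the average of the letter laws is
admissible. On such laws both terms are concave: the entropies entering with a minus sign have a
fixed conditional law (`W` or `Q`) and are therefore affine. Fano's inequality and division by `n`
finish the converse.

Both maxima are attained by compactness and continuity, and the bounds compare because `I(X₁;S|Y₃) ≥
0`. Strictness: take `Y₂ = X₁`, `Y₃ = X₁ + S` with uniform `S`. Then `(X₁,Y₃)` reveals `S`, so the
second term is at most `log 2 - log 2 = 0`, while the trivial bound is at least `log 2`. -/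

open Classical in
lemma marginal_eq_sum_ite (P : Ω → ℝ) (f : Ω → α) (a : α) :
    marginal P f a = ∑ ω, if f ω = a then P ω else 0 := by
  simp only [marginal, Set.indicator_apply, Set.mem_preimage, Set.mem_singleton_iff]

lemma marginal_nonneg {P : Ω → ℝ} (hP : 0 ≤ P) (f : Ω → α) (a : α) : 0 ≤ marginal P f a :=
  Finset.sum_nonneg fun ω _ => Set.indicator_nonneg (fun x _ => hP x) ω

lemma le_marginal {P : Ω → ℝ} (hP : 0 ≤ P) (f : Ω → α) (ω : Ω) : P ω ≤ marginal P f (f ω) := by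
  classical
  rw [marginal_eq_sum_ite]
  have := Finset.single_le_sum (f := fun ω' => if f ω' = f ω then P ω' else 0)
    (fun i _ => by split_ifs; exacts [hP i, le_rfl]) (Finset.mem_univ ω)
  simpa using this

lemma marginal_pos {P : Ω → ℝ} (hP : 0 ≤ P) (f : Ω → α) {ω : Ω} (h : P ω ≠ 0) :
    0 < marginal P f (f ω) :=
  lt_of_lt_of_le (lt_of_le_of_ne (hP ω) (Ne.symm h)) (le_marginal hP f ω)

lemma marginal_congr (P : Ω → ℝ) {f : Ω → α} {g : Ω → β} {a : α} {b : β}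
    (h : ∀ ω, f ω = a ↔ g ω = b) : marginal P f a = marginal P g b := by
  classical
  simp only [marginal_eq_sum_ite, h]

lemma marginal_eq_zero (P : Ω → ℝ) {f : Ω → α} {a : α} (h : ∀ ω, f ω ≠ a) :
    marginal P f a = 0 := by
  classical
  simp [marginal_eq_sum_ite, h]

lemma marginal_id (P : Ω → ℝ) (ω : Ω) : marginal P (fun ω => ω) ω = P ω := by
  classical
  simp [marginal_eq_sum_ite]

lemma sum_marginal_mul [Fintype α] (P : Ω → ℝ) (f : Ω → α) (φ : α → ℝ) :
    ∑ a, marginal P f a * φ a = ∑ ω, P ω * φ (f ω) := by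
  classical
  simp only [marginal_eq_sum_ite, Finset.sum_mul]
  rw [Finset.sum_comm]
  simp [ite_mul]

lemma sum_marginal [Fintype α] (P : Ω → ℝ) (f : Ω → α) : ∑ a, marginal P f a = ∑ ω, P ω := by
  simpa using sum_marginal_mul P f fun _ => 1

lemma marginal_marginal [Fintype α] (P : Ω → ℝ) (f : Ω → α) (g : α → β) (b : β) :
    marginal (marginal P f) g b = marginal P (fun ω => g (f ω)) b := by
  classical
  have := sum_marginal_mul P f fun a => if g a = b then 1 else 0
  simpa [marginal_eq_sum_ite (f := g), marginal_eq_sum_ite (f := fun ω => g (f ω))] using this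

lemma sum_marginal_prodMk [Fintype ζ] (P : Ω → ℝ) (Z : Ω → ζ) (G : Ω → γ) (g : γ) :
    ∑ z, marginal P (fun ω => (Z ω, G ω)) (z, g) = marginal P G g := by
  classical
  simp only [marginal_eq_sum_ite, Prod.mk.injEq]
  rw [Finset.sum_comm]
  refine Finset.sum_congr rfl fun ω _ => ?_
  by_cases h : G ω = g <;> simp [h]

lemma marginal_finset_sum {ι : Type*} (s : Finset ι) (P : ι → Ω → ℝ) (f : Ω → α) (a : α) :
    marginal (fun ω => ∑ i ∈ s, P i ω) f a = ∑ i ∈ s, marginal (P i) f a := by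
  classical
  simp only [marginal_eq_sum_ite]
  rw [Finset.sum_comm]
  refine Finset.sum_congr rfl fun ω _ => ?_
  split_ifs <;> simp

lemma marginal_const_mul (c : ℝ) (P : Ω → ℝ) (f : Ω → α) (a : α) :
    marginal (fun ω => c * P ω) f a = c * marginal P f a := by
  classical
  simp [marginal_eq_sum_ite, Finset.mul_sum]

/-- The entropy (in nats) of `f` under the mass function `P`. -/
noncomputable def ent (P : Ω → ℝ) (f : Ω → α) : ℝ :=
  -∑ ω, P ω * Real.log (marginal P f (f ω))

/-- The conditional entropy (in nats) of `Z` given `G` under the mass function `P`. -/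
noncomputable def condEnt (P : Ω → ℝ) (Z : Ω → ζ) (G : Ω → γ) : ℝ :=
  ent P (fun ω => (Z ω, G ω)) - ent P G

/-- Entropy sees only the partition of `Ω` into fibres; this justifies every regrouping of tuples
below. -/
lemma ent_congr (P : Ω → ℝ) {f : Ω → α} {g : Ω → β} (h : ∀ ω ω', f ω = f ω' ↔ g ω = g ω') :
    ent P f = ent P g := by
  unfold ent
  congr 1
  exact Finset.sum_congr rfl fun ω _ => by rw [marginal_congr P fun ω' => h ω' ω]

lemma ent_marginal [Fintype α] (P : Ω → ℝ) (f : Ω → α) (g : α → β) :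
    ent (marginal P f) g = ent P fun ω => g (f ω) := by
  simp only [ent, marginal_marginal]
  rw [sum_marginal_mul P f fun a => Real.log (marginal P (fun ω => g (f ω)) (g a))]

lemma condEnt_marginal [Fintype α] (P : Ω → ℝ) (f : Ω → α) (Z : α → ζ) (G : α → γ) :
    condEnt (marginal P f) Z G = condEnt P (fun ω => Z (f ω)) fun ω => G (f ω) := by
  simp only [condEnt, ent_marginal]

lemma ent_eq_sum_negMulLog [Fintype α] (P : Ω → ℝ) (f : Ω → α) :
    ent P f = ∑ a, Real.negMulLog (marginal P f a) := by
  simp only [ent, Real.negMulLog, neg_mul, Finset.sum_neg_distrib]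
  rw [← sum_marginal_mul P f fun a => Real.log (marginal P f a)]

lemma condEnt_eq_neg_sum {P : Ω → ℝ} (hP : 0 ≤ P) (Z : Ω → ζ) (G : Ω → γ) :
    condEnt P Z G = -∑ ω, P ω * Real.log
      (marginal P (fun ω => (Z ω, G ω)) (Z ω, G ω) / marginal P G (G ω)) := by
  simp only [condEnt, ent]
  rw [neg_sub_neg, ← Finset.sum_sub_distrib, ← Finset.sum_neg_distrib]
  refine Finset.sum_congr rfl fun ω _ => ?_
  by_cases h : P ω = 0
  · simp [h]
  rw [Real.log_div (marginal_pos hP (fun ω => (Z ω, G ω)) h).ne' (marginal_pos hP G h).ne']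
  ring

/-- Gibbs' inequality: the conditional entropy is at most the cross entropy relative to any
family of subprobability mass functions. -/
lemma condEnt_le_cross [Fintype ζ] [Fintype γ] {P : Ω → ℝ} (hP : 0 ≤ P) (Z : Ω → ζ) (G : Ω → γ)
    (q : γ → ζ → ℝ) (hq : ∀ g z, 0 ≤ q g z) (hq1 : ∀ g, ∑ z, q g z ≤ 1)
    (hpos : ∀ ω, P ω ≠ 0 → q (G ω) (Z ω) ≠ 0) :
    condEnt P Z G ≤ -∑ ω, P ω * Real.log (q (G ω) (Z ω)) := by
  rw [condEnt_eq_neg_sum hP]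
  set J := marginal P fun ω => (Z ω, G ω) with hJ
  set N := marginal P G with hN
  -- With `log t ≤ t - 1` at the ratio `t` of `q` to the true conditional law, it suffices that `t`
  -- has `P`-sum at most the total mass.
  have key : ∑ ω, P ω * (q (G ω) (Z ω) * N (G ω) / J (Z ω, G ω)) ≤ ∑ ω, P ω := by
    rw [← sum_marginal_mul P (fun ω => (Z ω, G ω)) fun x => q x.2 x.1 * N x.2 / J x,
      ← sum_marginal P G, Fintype.sum_prod_type, Finset.sum_comm]
    refine Finset.sum_le_sum fun g _ => ?_
    calc ∑ z, J (z, g) * (q g z * N g / J (z, g)) ≤ ∑ z, q g z * N g := by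
          refine Finset.sum_le_sum fun z _ => ?_
          have h0 : 0 ≤ q g z * N g := mul_nonneg (hq _ _) (marginal_nonneg hP _ _)
          by_cases h : J (z, g) = 0
          · simpa [h] using h0
          · rw [mul_div_cancel₀ _ h]
      _ = (∑ z, q g z) * N g := by rw [Finset.sum_mul]
      _ ≤ N g := mul_le_of_le_one_left (marginal_nonneg hP _ _) (hq1 g)
  have hterm : ∀ ω, P ω * Real.log (q (G ω) (Z ω)) - P ω * Real.log (J (Z ω, G ω) / N (G ω)) ≤
      P ω * (q (G ω) (Z ω) * N (G ω) / J (Z ω, G ω)) - P ω := by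
    intro ω
    by_cases h : P ω = 0
    · simp [h]
    have hJp : 0 < J (Z ω, G ω) := marginal_pos hP (fun ω => (Z ω, G ω)) h
    have hNp : 0 < N (G ω) := marginal_pos hP G h
    have hqp : 0 < q (G ω) (Z ω) := lt_of_le_of_ne (hq _ _) (hpos ω h).symm
    have := Real.log_le_sub_one_of_pos (div_pos (mul_pos hqp hNp) hJp)
    rw [Real.log_div (mul_pos hqp hNp).ne' hJp.ne', Real.log_mul hqp.ne' hNp.ne'] at this
    rw [Real.log_div hJp.ne' hNp.ne']
    have := mul_le_mul_of_nonneg_left this (hP ω)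
    linarith
  have := Finset.sum_le_sum fun ω (_ : ω ∈ Finset.univ) => hterm ω
  rw [Finset.sum_sub_distrib, Finset.sum_sub_distrib] at this
  linarith

/-- Conditioning on a finer variable reduces entropy. -/
lemma condEnt_le_condEnt [Fintype ζ] [Fintype γ] [Fintype β] {P : Ω → ℝ} (hP : 0 ≤ P) (Z : Ω → ζ)
    {G : Ω → γ} {H : Ω → β} (hGH : ∀ ω ω', G ω = G ω' → H ω = H ω') :
    condEnt P Z G ≤ condEnt P Z H := by
  have h1 : condEnt P Z G = condEnt P Z fun ω => (G ω, H ω) := by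
    unfold condEnt
    congr 1
    · exact ent_congr P fun ω ω' => by
        simp only [Prod.mk.injEq]
        exact ⟨fun h => ⟨h.1, h.2, hGH _ _ h.2⟩, fun h => ⟨h.1, h.2.1⟩⟩
    · exact ent_congr P fun ω ω' => by
        simp only [Prod.mk.injEq]
        exact ⟨fun h => ⟨h, hGH _ _ h⟩, fun h => h.1⟩
  -- Gibbs with the test law `p(z|h)`, viewed as a kernel from the pair `(g, h)` that ignores `g`.
  rw [h1, condEnt_eq_neg_sum hP Z H]
  refine condEnt_le_cross hP Z (fun ω => (G ω, H ω))
    (fun g z => marginal P (fun ω => (Z ω, H ω)) (z, g.2) / marginal P H g.2)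
    (fun g z => div_nonneg (marginal_nonneg hP _ _) (marginal_nonneg hP _ _)) (fun g => ?_)
    fun ω h => (div_pos (marginal_pos hP (fun ω => (Z ω, H ω)) h) (marginal_pos hP H h)).ne'
  rw [← Finset.sum_div, sum_marginal_prodMk]
  exact div_self_le_one _

/-- Under `P`, the conditional law of `Z` given `G` is `κ`. -/
def HasKernel (P : Ω → ℝ) (Z : Ω → ζ) (G : Ω → γ) (κ : γ → ζ → ℝ) : Prop :=
  ∀ g z, marginal P (fun ω => (Z ω, G ω)) (z, g) = marginal P G g * κ g z

/-- For a fixed kernel the right side is linear in `P`: this makes the subtracted entropies affine.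
-/
lemma HasKernel.condEnt_eq {P : Ω → ℝ} (hP : 0 ≤ P) {Z : Ω → ζ} {G : Ω → γ} {κ : γ → ζ → ℝ}
    (h : HasKernel P Z G κ) : condEnt P Z G = -∑ ω, P ω * Real.log (κ (G ω) (Z ω)) := by
  rw [condEnt_eq_neg_sum hP]
  congr 1
  refine Finset.sum_congr rfl fun ω _ => ?_
  by_cases h0 : P ω = 0
  · simp [h0]
  rw [h, mul_div_cancel_left₀ _ (marginal_pos hP G h0).ne']

lemma HasKernel.of_range {P : Ω → ℝ} {Z : Ω → ζ} {G : Ω → γ} {κ : γ → ζ → ℝ}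
    (h : ∀ ω z, marginal P (fun ω => (Z ω, G ω)) (z, G ω) = marginal P G (G ω) * κ (G ω) z) :
    HasKernel P Z G κ := by
  intro g z
  by_cases hg : ∃ ω, G ω = g
  · obtain ⟨ω, rfl⟩ := hg
    exact h ω z
  · push Not at hg
    rw [marginal_eq_zero P hg, zero_mul, marginal_eq_zero]
    intro ω hω
    exact hg ω (Prod.ext_iff.1 hω).2

/-- A kernel that depends on the conditioning variable through a function of it only is also the
conditional law given that function. -/
lemma HasKernel.comp [Fintype γ] [Fintype ζ] {P : Ω → ℝ} {Z : Ω → ζ} {G : Ω → γ} {h : γ → β}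
    {κ : β → ζ → ℝ} (hκ : HasKernel P Z G fun g => κ (h g)) :
    HasKernel P Z (fun ω => h (G ω)) κ := by
  classical
  intro b z
  rw [← marginal_marginal P G h, ← marginal_marginal P (fun ω => (Z ω, G ω)) fun x => (x.1, h x.2)]
  rw [marginal_eq_sum_ite, marginal_eq_sum_ite, Fintype.sum_prod_type, Finset.sum_mul,
    Finset.sum_comm]
  refine Finset.sum_congr rfl fun g _ => ?_
  by_cases hg : h g = b
  · simp [hg, hκ g z]
  · simp [hg]

/-- The conditional law of a function of `Z`. -/
lemma HasKernel.map [Fintype ζ] {P : Ω → ℝ} {Z : Ω → ζ} {G : Ω → γ}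
    {κ : γ → ζ → ℝ} (hκ : HasKernel P Z G κ) (φ : ζ → β) :
    HasKernel P (fun ω => φ (Z ω)) G fun g => marginal (κ g) φ := by
  classical
  intro g b
  have h1 : marginal P (fun ω => (φ (Z ω), G ω)) (b, g) =
      ∑ z, if φ z = b then marginal P (fun ω => (Z ω, G ω)) (z, g) else 0 := by
    simp only [marginal_eq_sum_ite, Prod.mk.injEq, ← Finset.sum_filter]
    rw [Finset.sum_comm' (t' := Finset.univ.filter fun ω => φ (Z ω) = b ∧ G ω = g)
      (s' := fun ω => {Z ω})]
    · simp
    · intro z ω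
      simp only [Finset.mem_filter, Finset.mem_univ, true_and, Finset.mem_singleton]
      constructor
      · rintro ⟨h, rfl, h'⟩; exact ⟨rfl, h, h'⟩
      · rintro ⟨rfl, h, h'⟩; exact ⟨h, rfl, h'⟩
  rw [h1]
  simp only [marginal_eq_sum_ite (κ g), Finset.mul_sum]
  refine Finset.sum_congr rfl fun z _ => ?_
  split_ifs
  · exact hκ g z
  · simp

lemma ent_prodMk_index {ι : Type*} [Fintype ι] (P : ι → Ω → ℝ) (f : Ω → α) :
    ent (fun x : ι × Ω => P x.1 x.2) (fun x => (f x.2, x.1)) = ∑ i, ent (P i) f := by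
  classical
  simp only [ent, Fintype.sum_prod_type, Finset.sum_neg_distrib]
  congr 1
  refine Finset.sum_congr rfl fun i _ => Finset.sum_congr rfl fun ω _ => ?_
  congr 2
  simp only [marginal_eq_sum_ite, Fintype.sum_prod_type, Prod.mk.injEq]
  rw [Finset.sum_eq_single i]
  · simp
  · intro j _ hj; simp [hj]
  · simp

/-- Conditional entropy is superadditive in the mass function. -/
lemma sum_condEnt_le {ι : Type*} [Fintype ι] [Fintype ζ] [Fintype γ] {P : ι → Ω → ℝ}
    (hP : ∀ i, 0 ≤ P i) (Z : Ω → ζ) (G : Ω → γ) :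
    ∑ i, condEnt (P i) Z G ≤ condEnt (fun ω => ∑ i, P i ω) Z G := by
  classical
  -- Adjoin the index as a coordinate: conditioning on it as well yields the sum, and forgetting it
  -- can only increase the entropy.
  let P' : ι × Ω → ℝ := fun x => P x.1 x.2
  have hP' : 0 ≤ P' := fun x => hP x.1 x.2
  have hmap : (fun ω => ∑ i, P i ω) = marginal P' Prod.snd := by
    funext ω
    simp [marginal_eq_sum_ite, Fintype.sum_prod_type, P']
  have hG : condEnt P' (fun x => Z x.2) (fun x => (G x.2, x.1)) = ∑ i, condEnt (P i) Z G := by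
    simp only [condEnt, Finset.sum_sub_distrib]
    rw [← ent_prodMk_index P fun ω => (Z ω, G ω), ← ent_prodMk_index P G]
    congr 1
    exact ent_congr P' fun x x' => by simp only [Prod.mk.injEq]; tauto
  rw [hmap, condEnt_marginal, ← hG]
  exact condEnt_le_condEnt hP' _ fun x x' h => (Prod.ext_iff.1 h).1

lemma condEnt_nonneg {P : Ω → ℝ} (hP : 0 ≤ P) (Z : Ω → ζ) (G : Ω → γ) : 0 ≤ condEnt P Z G := by
  classical
  rw [condEnt_eq_neg_sum hP, neg_nonneg]
  refine Finset.sum_nonpos fun ω _ => mul_nonpos_of_nonneg_of_nonpos (hP ω) ?_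
  refine Real.log_nonpos (div_nonneg (marginal_nonneg hP _ _) (marginal_nonneg hP _ _))
    (div_le_one_of_le₀ ?_ (marginal_nonneg hP _ _))
  simp only [marginal_eq_sum_ite]
  refine Finset.sum_le_sum fun ω' _ => ?_
  by_cases h : G ω' = G ω
  · by_cases h' : Z ω' = Z ω
    · simp [h, h']
    · simpa [h, h'] using hP ω'
  · simp [h]

lemma condEnt_const_mul {P : Ω → ℝ} (hP : 0 ≤ P) {c : ℝ} (hc : 0 < c) (Z : Ω → ζ) (G : Ω → γ) :
    condEnt (fun ω => c * P ω) Z G = c * condEnt P Z G := by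
  rw [condEnt_eq_neg_sum hP, condEnt_eq_neg_sum fun ω => mul_nonneg hc.le (hP ω)]
  simp only [marginal_const_mul, mul_div_mul_left _ _ hc.ne', mul_neg, Finset.mul_sum, mul_assoc]

lemma condMutualInfo_eq [Fintype α] [Fintype β] [Fintype γ] {P : Ω → ℝ} (hP : 0 ≤ P) (A : Ω → α)
    (B : Ω → β) (C : Ω → γ) :
    condMutualInfo P A B C = ent P (fun ω => (A ω, C ω)) + ent P (fun ω => (B ω, C ω)) -
      ent P (fun ω => (A ω, B ω, C ω)) - ent P C := by
  have h := sum_marginal_mul P (fun ω => (A ω, B ω, C ω)) fun x => Real.log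
        (marginal P (fun ω => (A ω, B ω, C ω)) x * marginal P C x.2.2 /
          (marginal P (fun ω => (A ω, C ω)) (x.1, x.2.2) *
            marginal P (fun ω => (B ω, C ω)) (x.2.1, x.2.2)))
  simp only [Fintype.sum_prod_type] at h
  rw [condMutualInfo, h]
  simp only [ent, ← Finset.sum_neg_distrib]
  rw [← Finset.sum_add_distrib, ← Finset.sum_sub_distrib, ← Finset.sum_sub_distrib]
  refine Finset.sum_congr rfl fun ω _ => ?_
  by_cases h0 : P ω = 0
  · simp [h0]
  have h1 := (marginal_pos hP (fun ω => (A ω, B ω, C ω)) h0).ne'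
  have h2 := (marginal_pos hP (fun ω => (A ω, C ω)) h0).ne'
  have h3 := (marginal_pos hP (fun ω => (B ω, C ω)) h0).ne'
  have h4 := (marginal_pos hP C h0).ne'
  rw [Real.log_div (mul_ne_zero h1 h4) (mul_ne_zero h2 h3), Real.log_mul h1 h4, Real.log_mul h2 h3]
  ring

lemma condMutualInfo_eq_condEnt_sub [Fintype α] [Fintype β] [Fintype γ] {P : Ω → ℝ} (hP : 0 ≤ P)
    (A : Ω → α) (B : Ω → β) (C : Ω → γ) :
    condMutualInfo P A B C = condEnt P B C - condEnt P B fun ω => (A ω, C ω) := by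
  rw [condMutualInfo_eq hP, condEnt, condEnt,
    ent_congr P (f := fun ω => (B ω, A ω, C ω)) (g := fun ω => (A ω, B ω, C ω))
      fun ω ω' => by simp only [Prod.mk.injEq]; tauto]
  ring

lemma condMutualInfo_nonneg [Fintype α] [Fintype β] [Fintype γ] {P : Ω → ℝ} (hP : 0 ≤ P)
    (A : Ω → α) (B : Ω → β) (C : Ω → γ) : 0 ≤ condMutualInfo P A B C := by
  rw [condMutualInfo_eq_condEnt_sub hP, sub_nonneg]
  exact condEnt_le_condEnt hP B fun ω ω' h => (Prod.ext_iff.1 h).2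

lemma continuous_marginal (f : Ω → α) (a : α) : Continuous fun P : Ω → ℝ => marginal P f a := by
  classical
  simp only [marginal_eq_sum_ite]
  refine continuous_finsetSum _ fun ω _ => ?_
  split_ifs <;> fun_prop

/-- `negMulLog` is continuous at `0`, so laws without full support cause no trouble. -/
lemma continuous_ent [Fintype α] (f : Ω → α) : Continuous fun P : Ω → ℝ => ent P f := by
  simp only [ent_eq_sum_negMulLog]
  exact continuous_finsetSum _ fun a _ => Real.continuous_negMulLog.comp (continuous_marginal f a)

lemma continuousOn_condMutualInfo [Fintype α] [Fintype β] [Fintype γ] (A : Ω → α) (B : Ω → β)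
    (C : Ω → γ) : ContinuousOn (fun P : Ω → ℝ => condMutualInfo P A B C) {P | 0 ≤ P} := by
  refine ContinuousOn.congr (f := fun P => ent P (fun ω => (A ω, C ω)) +
    ent P (fun ω => (B ω, C ω)) - ent P (fun ω => (A ω, B ω, C ω)) - ent P C) ?_
    fun P hP => condMutualInfo_eq hP A B C
  exact ((((continuous_ent _).add (continuous_ent _)).sub (continuous_ent _)).sub
    (continuous_ent _)).continuousOn

end Entropy

/-! ### Attainment of the two bounds, their comparison, and their entropy forms. -/

namespace RelayChannel

section Bounds

variable {X₁ X₂ S Y₂ Y₃ : Type*} [Fintype S] [Fintype Y₂] [Fintype Y₃]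
  (C : RelayChannel X₁ X₂ S Y₂ Y₃)

lemma Q_nonneg (s : S) : 0 ≤ C.Q s := C.Q_mem.1 s

lemma sum_Q : ∑ s, C.Q s = 1 := C.Q_mem.2

lemma W_nonneg (x₁ : X₁) (x₂ : X₂) (s : S) (y : Y₂ × Y₃) : 0 ≤ C.W x₁ x₂ s y :=
  (C.W_mem x₁ x₂ s).1 y

lemma sum_W (x₁ : X₁) (x₂ : X₂) (s : S) : ∑ y, C.W x₁ x₂ s y = 1 := (C.W_mem x₁ x₂ s).2

variable [Fintype X₁] [Fintype X₂]

lemma outerMeasures_subset_trivMeasures : C.outerMeasures ⊆ C.trivMeasures := by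
  rintro P ⟨p₁, p₂, h₁, h₂, rfl⟩
  exact ⟨fun _ => p₁, p₂, fun _ => h₁, h₂, rfl⟩

lemma nonneg_of_mem_trivMeasures {P : S × X₁ × X₂ × Y₂ × Y₃ → ℝ} (h : P ∈ C.trivMeasures) :
    0 ≤ P := by
  obtain ⟨p₁, p₂, h₁, h₂, rfl⟩ := h
  rintro ⟨s, x₁, x₂, y⟩
  exact mul_nonneg (mul_nonneg (mul_nonneg (C.Q_nonneg s) ((h₁ s).1 x₁)) ((h₂ x₁ s).1 x₂))
    (C.W_nonneg _ _ _ _)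

lemma marginal_state_of_mem_trivMeasures {P : S × X₁ × X₂ × Y₂ × Y₃ → ℝ}
    (h : P ∈ C.trivMeasures) (s : S) : marginal P (fun z => z.1) s = C.Q s := by
  classical
  obtain ⟨p₁, p₂, h₁, h₂, rfl⟩ := h
  have e : ∀ s', ∑ z : X₁ × X₂ × Y₂ × Y₃, C.Q s' * p₁ s' z.1 * p₂ z.1 s' z.2.1 *
      C.W z.1 z.2.1 s' z.2.2 = C.Q s' := by
    intro s'
    simp only [Fintype.sum_prod_type (α₁ := X₁), Fintype.sum_prod_type (α₁ := X₂),
      ← Finset.mul_sum, sum_W, mul_one, (h₂ _ _).2, (h₁ _).2]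
  rw [marginal_eq_sum_ite, Fintype.sum_prod_type, Finset.sum_eq_single s]
  · simpa using e s
  · intro s' _ hs
    simp [hs]
  · simp

/-- The set is the continuous image of a product of simplices. -/
lemma isCompact_outerMeasures : IsCompact C.outerMeasures := by
  have hK : IsCompact (stdSimplex ℝ X₁ ×ˢ
      Set.univ.pi fun _ : X₁ => Set.univ.pi fun _ : S => stdSimplex ℝ X₂) :=
    (isCompact_stdSimplex ℝ X₁).prod
      (isCompact_univ_pi fun _ => isCompact_univ_pi fun _ => isCompact_stdSimplex ℝ X₂)
  convert hK.image (f := fun (p : (X₁ → ℝ) × (X₁ → S → X₂ → ℝ)) (z : S × X₁ × X₂ × Y₂ × Y₃) =>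
    C.Q z.1 * p.1 z.2.1 * p.2 z.2.1 z.1 z.2.2.1 * C.W z.2.1 z.2.2.1 z.1 z.2.2.2)
    (by fun_prop) using 1
  ext P
  simp only [outerMeasures, Set.mem_ofPred_eq, Set.mem_image, Set.mem_prod, Set.mem_univ_pi,
    Prod.exists]
  constructor
  · rintro ⟨p₁, p₂, h₁, h₂, rfl⟩
    exact ⟨p₁, p₂, ⟨h₁, h₂⟩, rfl⟩
  · rintro ⟨p₁, p₂, ⟨h₁, h₂⟩, rfl⟩
    exact ⟨p₁, p₂, h₁, h₂, rfl⟩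

lemma isCompact_trivMeasures : IsCompact C.trivMeasures := by
  have hK : IsCompact ((Set.univ.pi fun _ : S => stdSimplex ℝ X₁) ×ˢ
      Set.univ.pi fun _ : X₁ => Set.univ.pi fun _ : S => stdSimplex ℝ X₂) :=
    (isCompact_univ_pi fun _ => isCompact_stdSimplex ℝ X₁).prod
      (isCompact_univ_pi fun _ => isCompact_univ_pi fun _ => isCompact_stdSimplex ℝ X₂)
  convert hK.image (f := fun (p : (S → X₁ → ℝ) × (X₁ → S → X₂ → ℝ)) (z : S × X₁ × X₂ × Y₂ × Y₃) =>
    C.Q z.1 * p.1 z.1 z.2.1 * p.2 z.2.1 z.1 z.2.2.1 * C.W z.2.1 z.2.2.1 z.1 z.2.2.2)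
    (by fun_prop) using 1
  ext P
  simp only [trivMeasures, Set.mem_ofPred_eq, Set.mem_image, Set.mem_prod, Set.mem_univ_pi,
    Prod.exists]
  constructor
  · rintro ⟨p₁, p₂, h₁, h₂, rfl⟩
    exact ⟨p₁, p₂, ⟨h₁, h₂⟩, rfl⟩
  · rintro ⟨p₁, p₂, ⟨h₁, h₂⟩, rfl⟩
    exact ⟨p₁, p₂, h₁, h₂, rfl⟩

lemma outerMeasures_nonempty [Nonempty X₁] [Nonempty X₂] : C.outerMeasures.Nonempty := by
  classical
  exact ⟨_, Pi.single (Classical.arbitrary X₁) 1, fun _ _ => Pi.single (Classical.arbitrary X₂) 1,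
    single_mem_stdSimplex ℝ _, fun _ _ => single_mem_stdSimplex ℝ _, rfl⟩

lemma isGreatest_Rout [Nonempty X₁] [Nonempty X₂] : IsGreatest C.outerValues C.Rout := by
  refine (C.isCompact_outerMeasures.image_of_continuousOn ?_).isGreatest_sSup
    (C.outerMeasures_nonempty.image _)
  refine ContinuousOn.mono (s := {P | 0 ≤ P}) ?_ fun P hP =>
    C.nonneg_of_mem_trivMeasures (C.outerMeasures_subset_trivMeasures hP)
  exact ContinuousOn.inf (continuousOn_condMutualInfo _ _ _)
    ((continuousOn_condMutualInfo _ _ _).sub (continuousOn_condMutualInfo _ _ _))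

lemma isGreatest_Rtriv [Nonempty X₁] [Nonempty X₂] : IsGreatest C.trivValues C.Rtriv := by
  refine (C.isCompact_trivMeasures.image_of_continuousOn ?_).isGreatest_sSup
    ((C.outerMeasures_nonempty.mono C.outerMeasures_subset_trivMeasures).image _)
  refine ContinuousOn.mono (s := {P | 0 ≤ P}) ?_ fun P hP => C.nonneg_of_mem_trivMeasures hP
  exact ContinuousOn.inf (continuousOn_condMutualInfo _ _ _) (continuousOn_condMutualInfo _ _ _)

lemma Rout_le_Rtriv [Nonempty X₁] [Nonempty X₂] : C.Rout ≤ C.Rtriv := by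
  obtain ⟨P, hP, hPR⟩ := C.isGreatest_Rout.1
  have hP' := C.outerMeasures_subset_trivMeasures hP
  rw [← hPR]
  refine le_trans (min_le_min le_rfl ?_) (C.isGreatest_Rtriv.2 ⟨P, hP', rfl⟩)
  exact sub_le_self _ (condMutualInfo_nonneg (C.nonneg_of_mem_trivMeasures hP') _ _ _)

lemma broadcastInfo_eq {P : S × X₁ × X₂ × Y₂ × Y₃ → ℝ} (hP : 0 ≤ P) :
    broadcastInfo P = condEnt P (fun z => z.2.2.2) (fun z => (z.1, z.2.2.1)) -
      condEnt P (fun z => z.2.2.2) (fun z => (z.1, z.2.1, z.2.2.1)) := by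
  rw [broadcastInfo, condMutualInfo_eq_condEnt_sub hP]
  congr 1
  simp only [condEnt]
  congr 1 <;> exact ent_congr P fun z z' => by simp only [Prod.ext_iff]; tauto

lemma accessInfo_eq {P : S × X₁ × X₂ × Y₂ × Y₃ → ℝ} (hP : 0 ≤ P) :
    accessInfo P = condEnt P (fun z => z.2.2.2.2) (fun z => z.1) -
      condEnt P (fun z => z.2.2.2.2) (fun z => (z.1, z.2.1, z.2.2.1)) := by
  rw [accessInfo, condMutualInfo_eq_condEnt_sub hP]
  congr 1
  simp only [condEnt]
  congr 1 <;> exact ent_congr P fun z z' => by simp only [Prod.ext_iff]; tauto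

/-- `I(X₁,X₂;Y₃|S) - I(X₁;S|Y₃) = H(Y₃) - H(Y₃|S,X₁,X₂) + H(S|X₁,Y₃) - H(S)`. -/
lemma accessInfo_sub_penaltyInfo_eq {P : S × X₁ × X₂ × Y₂ × Y₃ → ℝ} (hP : 0 ≤ P) :
    accessInfo P - penaltyInfo P = condEnt P (fun z => z.2.2.2.2) (fun _ => ()) -
      condEnt P (fun z => z.2.2.2.2) (fun z => (z.1, z.2.1, z.2.2.1)) +
      condEnt P (fun z => z.1) (fun z => (z.2.1, z.2.2.2.2)) -
      condEnt P (fun z => z.1) (fun _ => ()) := by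
  rw [accessInfo_eq hP, penaltyInfo, condMutualInfo_eq_condEnt_sub hP]
  simp only [condEnt]
  rw [ent_congr P (f := fun z => (z.2.2.2.2, ())) (g := fun z => z.2.2.2.2) (by simp),
    ent_congr P (f := fun z => (z.1, ())) (g := fun z => z.1) (by simp),
    ent_congr P (f := fun z => (z.1, z.2.2.2.2)) (g := fun z => (z.2.2.2.2, z.1))
      fun z z' => by simp only [Prod.mk.injEq]; tauto]
  ring

end Bounds

end RelayChannel

/-! ### Averages of laws and the chain rule. -/

section Kernel

variable {Ω α β γ ζ ι : Type*} [Fintype ι]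

/-- The average of a finite family of mass functions. -/
noncomputable def average (P : ι → Ω → ℝ) : Ω → ℝ :=
  fun ω => (Fintype.card ι : ℝ)⁻¹ * ∑ i, P i ω

lemma average_nonneg {P : ι → Ω → ℝ} (hP : ∀ i, 0 ≤ P i) : 0 ≤ average P := fun ω =>
  mul_nonneg (by positivity) (Finset.sum_nonneg fun i _ => hP i ω)

variable [Fintype Ω]

lemma hasKernel_marginal_iff [Fintype α] {P : Ω → ℝ} {f : Ω → α} {Z : α → ζ} {G : α → γ}
    {κ : γ → ζ → ℝ} : HasKernel (marginal P f) Z G κ ↔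
      HasKernel P (fun ω => Z (f ω)) (fun ω => G (f ω)) κ := by
  simp only [HasKernel, marginal_marginal]

lemma HasKernel.condEnt_comp [Fintype γ] [Fintype ζ] {P : Ω → ℝ} (hP : 0 ≤ P) {Z : Ω → ζ}
    {G : Ω → γ} {h : γ → β} {κ : β → ζ → ℝ} (hκ : HasKernel P Z G fun g => κ (h g)) :
    condEnt P Z G = condEnt P Z fun ω => h (G ω) := by
  rw [hκ.condEnt_eq hP, hκ.comp.condEnt_eq hP]

lemma marginal_average (P : ι → Ω → ℝ) (f : Ω → α) (a : α) :
    marginal (average P) f a = (Fintype.card ι : ℝ)⁻¹ * ∑ i, marginal (P i) f a := by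
  unfold average
  rw [marginal_const_mul, marginal_finset_sum]

lemma HasKernel.average {P : ι → Ω → ℝ} {Z : Ω → ζ} {G : Ω → γ} {κ : γ → ζ → ℝ}
    (h : ∀ i, HasKernel (P i) Z G κ) : HasKernel (average P) Z G κ := by
  intro g z
  simp only [marginal_average, fun i => h i g z, Finset.sum_mul, mul_assoc]

lemma average_condEnt_le [Nonempty ι] [Fintype ζ] [Fintype γ] {P : ι → Ω → ℝ}
    (hP : ∀ i, 0 ≤ P i) (Z : Ω → ζ) (G : Ω → γ) :
    (Fintype.card ι : ℝ)⁻¹ * ∑ i, condEnt (P i) Z G ≤ condEnt (average P) Z G := by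
  have hc : 0 < (Fintype.card ι : ℝ)⁻¹ := by positivity
  unfold average
  rw [condEnt_const_mul (fun ω => Finset.sum_nonneg fun i _ => hP i ω) hc]
  exact mul_le_mul_of_nonneg_left (sum_condEnt_le hP Z G) hc.le

lemma HasKernel.condEnt_average {P : ι → Ω → ℝ} (hP : ∀ i, 0 ≤ P i) {Z : Ω → ζ} {G : Ω → γ}
    {κ : γ → ζ → ℝ} (h : ∀ i, HasKernel (P i) Z G κ) :
    condEnt (_root_.average P) Z G = (Fintype.card ι : ℝ)⁻¹ * ∑ i, condEnt (P i) Z G := by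
  rw [(HasKernel.average h).condEnt_eq (average_nonneg hP)]
  simp only [fun i => (h i).condEnt_eq (hP i), Finset.sum_neg_distrib, mul_neg]
  rw [Finset.sum_comm, Finset.mul_sum]
  simp only [_root_.average, Finset.sum_mul, mul_assoc]

/-- The first `k` letters of a word, padded by `a₀`. -/
def wordPrefix {n : ℕ} (a₀ : α) (k : ℕ) (v : Fin n → α) : Fin n → α :=
  fun j => if (j : ℕ) < k then v j else a₀

/-- Padding gives prefixes of all lengths one type; since the filler is common to both words, it
carries no information. -/
lemma wordPrefix_eq_iff {n : ℕ} (a₀ : α) (k : ℕ) (v w : Fin n → α) :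
    wordPrefix a₀ k v = wordPrefix a₀ k w ↔ ∀ j : Fin n, (j : ℕ) < k → v j = w j := by
  simp only [funext_iff, wordPrefix]
  refine forall_congr' fun j => ?_
  by_cases h : (j : ℕ) < k <;> simp [h]

lemma forall_lt_succ_iff {n : ℕ} (i : Fin n) (p : Fin n → Prop) :
    (∀ j : Fin n, (j : ℕ) < i + 1 → p j) ↔ p i ∧ ∀ j : Fin n, (j : ℕ) < i → p j := by
  constructor
  · exact fun h => ⟨h i (Nat.lt_succ_self _), fun j hj => h j (Nat.lt_succ_of_lt hj)⟩
  · rintro ⟨h, h'⟩ j hj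
    rcases Nat.lt_succ_iff_lt_or_eq.1 hj with hj | hj
    · exact h' j hj
    · rwa [Fin.ext hj]

/-- The chain rule for entropy. -/
lemma ent_chain {n : ℕ} (P : Ω → ℝ) (G : Ω → γ) (V : Ω → Fin n → α) (a₀ : α) :
    ent P (fun ω => (G ω, V ω)) - ent P G =
      ∑ i : Fin n, condEnt P (fun ω => V ω i) fun ω => (G ω, wordPrefix a₀ i (V ω)) := by
  -- The joint entropy of `G` and the first `k` letters; the chain rule is its telescoping sum.
  let e : ℕ → ℝ := fun k => ent P fun ω => (G ω, wordPrefix a₀ k (V ω))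
  have h0 : ent P G = e 0 := ent_congr P fun ω ω' => by
    simp [wordPrefix_eq_iff]
  have hn : ent P (fun ω => (G ω, V ω)) = e n := ent_congr P fun ω ω' => by
    simp only [Prod.mk.injEq, wordPrefix_eq_iff, Fin.is_lt, true_imp_iff]
    rw [funext_iff]
  rw [h0, hn, ← Finset.sum_range_sub, Finset.sum_range]
  refine Finset.sum_congr rfl fun i _ => ?_
  unfold condEnt
  congr 1
  exact ent_congr P fun ω ω' => by
    simp only [Prod.mk.injEq, wordPrefix_eq_iff, forall_lt_succ_iff]
    tauto

lemma marginal_prod_apply [Fintype α] {n : ℕ} {q : α → ℝ} (hq : ∑ a, q a = 1) (i : Fin n)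
    (a : α) : marginal (fun v : Fin n → α => ∏ j, q (v j)) (fun v => v i) a = q a := by
  classical
  -- Expand a product of sums whose `i`-th factor runs over `{a}` only; every other factor is `1`.
  have h := Finset.prod_univ_sum (fun j : Fin n => if j = i then ({a} : Finset α) else Finset.univ)
    (fun _ b => q b)
  rw [Finset.prod_eq_single i (fun j _ hj => by simp [hj, hq]) (by simp)] at h
  simp only [if_true, Finset.sum_singleton] at h
  rw [marginal_eq_sum_ite, ← Finset.sum_filter, h]
  refine Finset.sum_congr ?_ fun _ _ => rfl
  ext v
  simp only [Finset.mem_filter, Finset.mem_univ, true_and, Fintype.mem_piFinset]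
  constructor
  · intro hv j
    by_cases hj : j = i
    · simp [hj, hv]
    · simp [hj]
  · intro hv
    simpa using hv i

end Kernel

/-! ### Admissible single-letter laws and concavity under averaging. -/

namespace RelayChannel

variable {X₁ X₂ S Y₂ Y₃ : Type*} [Fintype X₁] [Fintype X₂] [Fintype S] [Fintype Y₂] [Fintype Y₃]
  (C : RelayChannel X₁ X₂ S Y₂ Y₃)

/-- Linear description of the joint laws of `(S, X₁, X₂, Y₂, Y₃)` for which `X₁` is independent of
the state and the outputs are produced by the channel. -/
structure IsOuterLaw (P : S × X₁ × X₂ × Y₂ × Y₃ → ℝ) : Prop where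
  nonneg : 0 ≤ P
  sum_eq_one : ∑ z, P z = 1
  state : HasKernel P (fun z => z.1) (fun z => z.2.1) fun _ => C.Q
  output : HasKernel P (fun z => z.2.2.2) (fun z => (z.1, z.2.1, z.2.2.1))
    fun g => C.W g.2.1 g.2.2 g.1

variable {C}

lemma IsOuterLaw.mem_outerMeasures [Nonempty X₂] {P : S × X₁ × X₂ × Y₂ × Y₃ → ℝ}
    (h : C.IsOuterLaw P) : P ∈ C.outerMeasures := by
  classical
  let m₂ : X₁ → S → ℝ := fun x₁ s => marginal P (fun z => (z.1, z.2.1)) (s, x₁)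
  let m₃ : X₁ → S → X₂ → ℝ := fun x₁ s x₂ => marginal P (fun z => (z.1, z.2.1, z.2.2.1)) (s, x₁, x₂)
  have hm : ∀ x₁ s, ∑ x₂, m₃ x₁ s x₂ = m₂ x₁ s := fun x₁ s => by
    simp only [m₂, m₃]
    rw [← sum_marginal_prodMk P fun z => z.2.2.1]
    exact Finset.sum_congr rfl fun x₂ _ => marginal_congr P fun z => by
      simp only [Prod.mk.injEq]; tauto
  have hm₃ : ∀ x₁ s x₂, 0 ≤ m₃ x₁ s x₂ := fun _ _ _ => marginal_nonneg h.nonneg _ _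
  -- Where `(x₁, s)` has mass zero the conditional law of `X₂` is undefined, and any point mass will
  -- do.
  refine ⟨marginal P fun z => z.2.1, fun x₁ s => if m₂ x₁ s = 0 then
    Pi.single (Classical.arbitrary X₂) 1 else fun x₂ => m₃ x₁ s x₂ / m₂ x₁ s,
    ⟨marginal_nonneg h.nonneg _, by rw [sum_marginal, h.sum_eq_one]⟩, fun x₁ s => ?_, ?_⟩
  · dsimp only
    split_ifs with h0
    · exact single_mem_stdSimplex ℝ _
    · exact ⟨fun x₂ => div_nonneg (hm₃ _ _ _) (marginal_nonneg h.nonneg _ _),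
        by rw [← Finset.sum_div, hm, div_self h0]⟩
  · funext ⟨s, x₁, x₂, y⟩
    have h1 : P (s, x₁, x₂, y) = m₃ x₁ s x₂ * C.W x₁ x₂ s y := by
      rw [← marginal_id P (s, x₁, x₂, y), ← h.output (s, x₁, x₂) y]
      exact marginal_congr P fun z => by simp only [Prod.ext_iff]; tauto
    have h2 : C.Q s * marginal P (fun z => z.2.1) x₁ = m₂ x₁ s := by
      rw [mul_comm, ← h.state x₁ s]
    rw [h1]
    dsimp only
    rw [h2]
    split_ifs with h0
    · have := (Finset.sum_eq_zero_iff_of_nonneg fun x₂ _ => hm₃ x₁ s x₂).1 ((hm x₁ s).trans h0) x₂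
        (Finset.mem_univ _)
      rw [this, h0]
      ring
    · rw [mul_div_cancel₀ _ h0]

section Average

variable {ι : Type*} [Fintype ι] [Nonempty ι] {P : ι → S × X₁ × X₂ × Y₂ × Y₃ → ℝ}

/-- Each condition is linear in the law because the kernels `Q` and `W` are common to all `P i`. -/
lemma IsOuterLaw.average (h : ∀ i, C.IsOuterLaw (P i)) : C.IsOuterLaw (average P) where
  nonneg := average_nonneg fun i => (h i).nonneg
  sum_eq_one := by
    simp only [_root_.average, ← Finset.mul_sum]
    rw [Finset.sum_comm]
    simp [(h _).sum_eq_one]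
  state := HasKernel.average fun i => (h i).state
  output := HasKernel.average fun i => (h i).output

lemma average_broadcastInfo_le (h : ∀ i, C.IsOuterLaw (P i)) :
    (Fintype.card ι : ℝ)⁻¹ * ∑ i, broadcastInfo (P i) ≤ broadcastInfo (average P) := by
  have h0 := fun i => (h i).nonneg
  rw [broadcastInfo_eq (average_nonneg h0)]
  simp only [fun i => broadcastInfo_eq (h0 i), Finset.sum_sub_distrib, mul_sub]
  rw [HasKernel.condEnt_average h0 fun i => (h i).output]
  exact sub_le_sub_right (average_condEnt_le h0 _ _) _

/-- `H(Y₃)` and `H(S|X₁,Y₃)` are concave; `H(Y₃|S,X₁,X₂)` and `H(S)` are affine, their kernels being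
fixed. -/
lemma average_accessInfo_sub_penaltyInfo_le (h : ∀ i, C.IsOuterLaw (P i)) :
    (Fintype.card ι : ℝ)⁻¹ * ∑ i, (accessInfo (P i) - penaltyInfo (P i)) ≤
      accessInfo (average P) - penaltyInfo (average P) := by
  have h0 := fun i => (h i).nonneg
  rw [accessInfo_sub_penaltyInfo_eq (average_nonneg h0)]
  simp only [fun i => accessInfo_sub_penaltyInfo_eq (h0 i), Finset.sum_sub_distrib,
    Finset.sum_add_distrib, mul_sub, mul_add]
  rw [HasKernel.condEnt_average h0 fun i => (h i).output.map Prod.snd,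
    HasKernel.condEnt_average h0 fun i => (h i).state.comp (h := fun _ => ()) (κ := fun _ => C.Q)]
  have := average_condEnt_le h0 (fun z => z.2.2.2.2) fun _ => ()
  have := average_condEnt_le h0 (fun z => z.1) fun z => (z.2.1, z.2.2.2.2)
  linarith

end Average

end RelayChannel

/-! ### The letters of a code. -/

section Code

variable {X₁ X₂ S Y₂ Y₃ : Type*} {n M : ℕ}

/-- The relay input at time `i`. -/
def RelayCode.relayInput (c : RelayCode X₁ X₂ S Y₂ Y₃ n M) (i : Fin n) (s : Fin n → S)
    (y : Fin n → Y₂ × Y₃) : X₂ :=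
  c.relay i s fun j => (y (Fin.castLE i.isLt.le j)).1

lemma RelayCode.relayInput_congr (c : RelayCode X₁ X₂ S Y₂ Y₃ n M) (i : Fin n) (s : Fin n → S)
    {y y' : Fin n → Y₂ × Y₃} (h : ∀ j : Fin n, (j : ℕ) < i → y j = y' j) :
    c.relayInput i s y = c.relayInput i s y' := by
  unfold RelayCode.relayInput
  congr 1
  funext j
  rw [h _ (by simp)]

lemma RelayCode.relayInput_wordPrefix (c : RelayCode X₁ X₂ S Y₂ Y₃ n M) (i : Fin n)
    (s : Fin n → S) (y₀ : Y₂ × Y₃) (y : Fin n → Y₂ × Y₃) :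
    c.relayInput i s (wordPrefix y₀ i y) = c.relayInput i s y :=
  c.relayInput_congr i s fun j hj => by simp [wordPrefix, hj]

/-- The state, the inputs and the outputs at time `i`. -/
def RelayCode.letter (c : RelayCode X₁ X₂ S Y₂ Y₃ n M) (i : Fin n)
    (ω : Fin M × (Fin n → S) × (Fin n → Y₂ × Y₃)) : S × X₁ × X₂ × Y₂ × Y₃ :=
  (ω.2.1 i, c.enc ω.1 i, c.relayInput i ω.2.1 ω.2.2, ω.2.2 i)

end Code

/-! ### The joint law of message, states and outputs. -/

namespace RelayChannel

variable {X₁ X₂ S Y₂ Y₃ : Type*} [Fintype S] [Fintype Y₂] [Fintype Y₃]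
  (C : RelayChannel X₁ X₂ S Y₂ Y₃) {n M : ℕ} (c : RelayCode X₁ X₂ S Y₂ Y₃ n M)

/-- The joint law of the message, the states and the first `k` outputs, as a function on the set of
all messages, states and outputs. -/
noncomputable def prefixLaw (k : ℕ) (ω : Fin M × (Fin n → S) × (Fin n → Y₂ × Y₃)) : ℝ :=
  (M : ℝ)⁻¹ * (∏ j, C.Q (ω.2.1 j)) * ∏ j : Fin n, if (j : ℕ) < k then
    C.W (c.enc ω.1 j) (c.relayInput j ω.2.1 ω.2.2) (ω.2.1 j) (ω.2.2 j) else 1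

/-- The joint law of the message, the states and the outputs. -/
noncomputable def codeLaw (ω : Fin M × (Fin n → S) × (Fin n → Y₂ × Y₃)) : ℝ :=
  (M : ℝ)⁻¹ * C.blockLaw c ω.1 ω.2.1 ω.2.2

lemma codeLaw_eq_prefixLaw (ω : Fin M × (Fin n → S) × (Fin n → Y₂ × Y₃)) :
    C.codeLaw c ω = C.prefixLaw c n ω := by
  simp only [codeLaw, blockLaw, prefixLaw, Fin.is_lt, if_true, Finset.prod_mul_distrib, mul_assoc,
    RelayCode.relayInput]

lemma codeLaw_nonneg : 0 ≤ C.codeLaw c := fun _ =>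
  mul_nonneg (by positivity)
    (Finset.prod_nonneg fun _ _ => mul_nonneg (C.Q_nonneg _) (C.W_nonneg _ _ _ _))

lemma Q_ne_zero_of_codeLaw_ne_zero {ω : Fin M × (Fin n → S) × (Fin n → Y₂ × Y₃)}
    (h : C.codeLaw c ω ≠ 0) (i : Fin n) : C.Q (ω.2.1 i) ≠ 0 := fun h0 => h <| by
  rw [codeLaw, blockLaw, Finset.prod_eq_zero (Finset.mem_univ i) (by rw [h0, zero_mul]), mul_zero]

lemma prefixLaw_succ (i : Fin n) (ω : Fin M × (Fin n → S) × (Fin n → Y₂ × Y₃)) :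
    C.prefixLaw c (i + 1) ω = C.prefixLaw c i ω *
      C.W (c.enc ω.1 i) (c.relayInput i ω.2.1 ω.2.2) (ω.2.1 i) (ω.2.2 i) := by
  simp only [prefixLaw, mul_assoc]
  congr 2
  set w : Fin n → ℝ := fun j => C.W (c.enc ω.1 j) (c.relayInput j ω.2.1 ω.2.2) (ω.2.1 j) (ω.2.2 j)
  have h : ∀ j : Fin n, (if (j : ℕ) < i + 1 then w j else 1) =
      (if (j : ℕ) < i then w j else 1) * if j = i then w j else 1 := by
    intro j
    rcases lt_trichotomy (j : ℕ) i with h | h | h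
    · simp [h, Nat.lt_succ_of_lt h, Fin.ext_iff, h.ne]
    · simp [Fin.ext h]
    · simp [Fin.ext_iff, h.ne', show ¬ (j : ℕ) < i by omega, show ¬ (j : ℕ) < i + 1 by omega]
  change (∏ j : Fin n, if (j : ℕ) < i + 1 then w j else 1) =
    (∏ j : Fin n, if (j : ℕ) < i then w j else 1) * w i
  simp only [h, Finset.prod_mul_distrib, Finset.prod_ite_eq', Finset.mem_univ, if_true]

/-- Causality: the factors before time `i` involve only outputs before time `i`. -/
lemma prefixLaw_update (i : Fin n) (m : Fin M) (s : Fin n → S) (y : Fin n → Y₂ × Y₃)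
    (b : Y₂ × Y₃) :
    C.prefixLaw c i (m, s, Function.update y i b) = C.prefixLaw c i (m, s, y) := by
  have hy : ∀ j : Fin n, (j : ℕ) < i → Function.update y i b j = y j := fun j hj =>
    Function.update_of_ne (fun h => by simp [h] at hj) _ _
  simp only [prefixLaw]
  congr 1
  refine Finset.prod_congr rfl fun j _ => ?_
  split_ifs with h
  · rw [hy j h, c.relayInput_congr j s fun k hk => hy k (hk.trans h)]
  · rfl

/-- The hypothesis `h` is the induction hypothesis of `marginal_codeLaw_prefix` at length `i + 1`,
evaluated at the word with `b` in place `i`. -/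
lemma marginal_codeLaw_output_prefix (y₀ : Y₂ × Y₃) (i : Fin n)
    (h : ∀ ω, marginal (C.codeLaw c) (fun ω => ((ω.1, ω.2.1), wordPrefix y₀ (i + 1) ω.2.2))
      ((ω.1, ω.2.1), wordPrefix y₀ (i + 1) ω.2.2) = C.prefixLaw c (i + 1) ω)
    (ω : Fin M × (Fin n → S) × (Fin n → Y₂ × Y₃)) (b : Y₂ × Y₃) :
    marginal (C.codeLaw c) (fun ω => (ω.2.2 i, (ω.1, ω.2.1), wordPrefix y₀ i ω.2.2))
      (b, (ω.1, ω.2.1), wordPrefix y₀ i ω.2.2) = C.prefixLaw c i ω *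
        C.W (c.enc ω.1 i) (c.relayInput i ω.2.1 ω.2.2) (ω.2.1 i) b := by
  obtain ⟨m, s, y⟩ := ω
  have hy : ∀ j : Fin n, (j : ℕ) < i → Function.update y i b j = y j := fun j hj =>
    Function.update_of_ne (fun h => by simp [h] at hj) _ _
  have h1 := h (m, s, Function.update y i b)
  rw [prefixLaw_succ, prefixLaw_update] at h1
  simp only [Function.update_self, c.relayInput_congr i s hy] at h1
  rw [← h1]
  refine marginal_congr _ fun ω => ?_
  simp only [Prod.mk.injEq, wordPrefix_eq_iff, forall_lt_succ_iff, Function.update_self]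
  have : (∀ j : Fin n, (j : ℕ) < i → ω.2.2 j = Function.update y i b j) ↔
      ∀ j : Fin n, (j : ℕ) < i → ω.2.2 j = y j :=
    forall_congr' fun j => imp_congr_right fun hj => by rw [hy j hj]
  rw [this]
  tauto

/-- Downward induction on `k`: the last remaining output is summed out, and its channel factor sums
to `1`. -/
lemma marginal_codeLaw_prefix (y₀ : Y₂ × Y₃) {k : ℕ} (hk : k ≤ n)
    (ω : Fin M × (Fin n → S) × (Fin n → Y₂ × Y₃)) :
    marginal (C.codeLaw c) (fun ω => ((ω.1, ω.2.1), wordPrefix y₀ k ω.2.2))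
      ((ω.1, ω.2.1), wordPrefix y₀ k ω.2.2) = C.prefixLaw c k ω := by
  induction hk using Nat.decreasingInduction generalizing ω with
  | self =>
    rw [← codeLaw_eq_prefixLaw, ← marginal_id (C.codeLaw c) ω]
    refine marginal_congr _ fun ω' => ?_
    simp only [Prod.ext_iff (x := ω'), Prod.mk.injEq, wordPrefix_eq_iff, Fin.is_lt, true_imp_iff,
      Prod.ext_iff (x := ω'.2), and_assoc]
    rw [funext_iff (f := ω'.2.2)]
  | of_succ k hk ih =>
    rw [← sum_marginal_prodMk _ fun ω => ω.2.2 ⟨k, hk⟩]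
    simp only [C.marginal_codeLaw_output_prefix c y₀ ⟨k, hk⟩ ih, ← Finset.mul_sum, sum_W, mul_one]

/-- Given the message, the states and the past outputs, the outputs are produced by the channel. -/
lemma hasKernel_output (y₀ : Y₂ × Y₃) (i : Fin n) :
    HasKernel (C.codeLaw c) (fun ω => ω.2.2 i)
      (fun ω => ((ω.1, ω.2.1), wordPrefix y₀ i ω.2.2))
      fun g => C.W (c.enc g.1.1 i) (c.relayInput i g.1.2 g.2) (g.1.2 i) := by
  refine HasKernel.of_range fun ω b => ?_
  rw [C.marginal_codeLaw_output_prefix c y₀ i fun ω => C.marginal_codeLaw_prefix c y₀ i.isLt ω,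
    C.marginal_codeLaw_prefix c y₀ i.isLt.le, c.relayInput_wordPrefix]

lemma marginal_codeLaw_state_message [Nonempty (Y₂ × Y₃)] (s : Fin n → S) (m : Fin M) :
    marginal (C.codeLaw c) (fun ω => (ω.2.1, ω.1)) (s, m) = (M : ℝ)⁻¹ * ∏ j, C.Q (s j) := by
  let y₀ := Classical.arbitrary (Y₂ × Y₃)
  have h := C.marginal_codeLaw_prefix c y₀ (Nat.zero_le n) (m, s, fun _ => y₀)
  simp only [prefixLaw, Nat.not_lt_zero, if_false, Finset.prod_const_one, mul_one] at h
  rw [← h]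
  refine marginal_congr _ fun ω => ?_
  simp only [Prod.mk.injEq, wordPrefix_eq_iff, Nat.not_lt_zero, false_imp_iff, implies_true]
  tauto

lemma sum_prod_Q : ∑ s : Fin n → S, ∏ j, C.Q (s j) = 1 := by
  classical
  simpa [C.sum_Q] using (Finset.prod_univ_sum (fun _ : Fin n => Finset.univ) fun _ => C.Q).symm

lemma marginal_codeLaw_message [Nonempty (Y₂ × Y₃)] (m : Fin M) :
    marginal (C.codeLaw c) (fun ω => ω.1) m = (M : ℝ)⁻¹ := by
  rw [← sum_marginal_prodMk _ fun ω => ω.2.1]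
  simp only [marginal_codeLaw_state_message, ← Finset.mul_sum, sum_prod_Q, mul_one]

/-- The states are independent of the message and of each other. -/
lemma hasKernel_states [Nonempty (Y₂ × Y₃)] :
    HasKernel (C.codeLaw c) (fun ω => ω.2.1) (fun ω => ω.1) fun _ s => ∏ j, C.Q (s j) :=
  fun m s => by rw [marginal_codeLaw_state_message, marginal_codeLaw_message]

lemma sum_codeLaw [Nonempty (Y₂ × Y₃)] (hM : M ≠ 0) : ∑ ω, C.codeLaw c ω = 1 := by
  rw [← sum_marginal _ fun ω => ω.1]
  simp [marginal_codeLaw_message, hM]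

lemma hasKernel_state [Nonempty (Y₂ × Y₃)] (i : Fin n) :
    HasKernel (C.codeLaw c) (fun ω => ω.2.1 i) (fun ω => ω.1) fun _ => C.Q := by
  intro m a
  rw [(C.hasKernel_states c).map (fun s => s i) m a]
  dsimp only
  rw [marginal_prod_apply C.sum_Q]

/-- `X₁` at time `i` is a function of the message, which is independent of the states. -/
lemma isOuterLaw_letter [Fintype X₁] [Fintype X₂] [Nonempty (Y₂ × Y₃)] (hM : M ≠ 0) (i : Fin n) :
    C.IsOuterLaw (marginal (C.codeLaw c) (c.letter i)) where
  nonneg := marginal_nonneg (C.codeLaw_nonneg c) _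
  sum_eq_one := by rw [sum_marginal, C.sum_codeLaw c hM]
  state := by
    rw [hasKernel_marginal_iff]
    exact (C.hasKernel_state c i).comp (h := fun m => c.enc m i) (κ := fun _ => C.Q)
  output := by
    rw [hasKernel_marginal_iff]
    have h := (C.hasKernel_output c (Classical.arbitrary _) i).comp
      (h := fun g : (Fin M × (Fin n → S)) × (Fin n → Y₂ × Y₃) =>
        (g.1.2 i, c.enc g.1.1 i, c.relayInput i g.1.2 g.2))
      (κ := fun x => C.W x.2.1 x.2.2 x.1)
    simpa only [c.relayInput_wordPrefix, RelayCode.letter] using h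

/-! ### Fano's inequality and the information about the message. -/

lemma errorProb_eq : C.errorProb c = ∑ ω : Fin M × (Fin n → S) × (Fin n → Y₂ × Y₃),
    if c.dec (fun i => (ω.2.2 i).2) = ω.1 then 0 else C.codeLaw c ω := by
  simp only [errorProb, Fintype.sum_prod_type, Finset.mul_sum, mul_ite, mul_zero, codeLaw]

lemma ent_codeLaw_unit [Nonempty (Y₂ × Y₃)] (hM : M ≠ 0) :
    ent (C.codeLaw c) (fun _ => ()) = 0 := by
  have h : ∀ u, marginal (C.codeLaw c) (fun _ => ()) u = 1 := by
    intro u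
    rw [← C.sum_codeLaw c hM, marginal_eq_sum_ite]
    simp
  simp [ent, h]

/-- Fano's inequality. -/
lemma condEnt_message_le [Nonempty (Y₂ × Y₃)] (hM : M ≠ 0) :
    condEnt (C.codeLaw c) (fun ω => ω.1) (fun ω i => (ω.2.2 i).2) ≤
      Real.log 2 + C.errorProb c * Real.log M := by
  have hM' : (0 : ℝ) < M := by positivity
  refine (condEnt_le_cross (C.codeLaw_nonneg c) _ _
    -- Test law: half on the decoded message, half spread uniformly. Its cost is `log 2`, plus `log
    -- M` on an error, so `log 2` replaces the binary entropy.
    (fun y m => if c.dec y = m then 1 / 2 else 1 / 2 * (M : ℝ)⁻¹)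
    (fun y m => by split_ifs <;> positivity) (fun y => ?_)
    fun ω _ => by split_ifs <;> positivity).trans ?_
  · calc ∑ m, (if c.dec y = m then (1 : ℝ) / 2 else 1 / 2 * (M : ℝ)⁻¹)
        ≤ ∑ m, ((if c.dec y = m then (1 : ℝ) / 2 else 0) + 1 / 2 * (M : ℝ)⁻¹) := by
          refine Finset.sum_le_sum fun m _ => ?_
          split_ifs
          · exact le_add_of_nonneg_right (by positivity)
          · simp
      _ = 1 := by
          rw [Finset.sum_add_distrib]
          simp [mul_left_comm _ (2 : ℝ)⁻¹, hM]
          norm_num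
  · have h2 : Real.log 2 = ∑ ω, C.codeLaw c ω * Real.log 2 := by
      rw [← Finset.sum_mul, C.sum_codeLaw c hM, one_mul]
    rw [← Finset.sum_neg_distrib, errorProb_eq, Finset.sum_mul, h2, ← Finset.sum_add_distrib]
    refine Finset.sum_le_sum fun ω _ => le_of_eq ?_
    split_ifs
    · simp
    · rw [Real.log_mul (by norm_num) (by positivity)]
      simp only [one_div, Real.log_inv]
      ring

/-- The mutual information between the message and the destination's outputs. -/
noncomputable def messageInfo : ℝ :=
  ent (C.codeLaw c) (fun ω => ω.1) -
    condEnt (C.codeLaw c) (fun ω => ω.1) (fun ω i => (ω.2.2 i).2)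

lemma log_le_messageInfo [Nonempty (Y₂ × Y₃)] (hM : M ≠ 0) :
    (1 - C.errorProb c) * Real.log M ≤ C.messageInfo c + Real.log 2 := by
  have h := C.condEnt_message_le c hM
  have h1 : ent (C.codeLaw c) (fun ω => ω.1) = Real.log M := by
    simp only [ent, marginal_codeLaw_message, ← Finset.sum_mul, C.sum_codeLaw c hM, Real.log_inv]
    ring
  rw [messageInfo, h1]
  linarith

lemma condEnt_states_message [Nonempty (Y₂ × Y₃)] :
    condEnt (C.codeLaw c) (fun ω => ω.2.1) (fun ω => ω.1) =
      condEnt (C.codeLaw c) (fun ω => ω.2.1) fun _ => () := by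
  have h := C.hasKernel_states c
  rw [h.condEnt_eq (C.codeLaw_nonneg c),
    (h.comp (h := fun _ => ()) (κ := fun _ s => ∏ j, C.Q (s j))).condEnt_eq (C.codeLaw_nonneg c)]

lemma condEnt_states_message_eq_sum [Nonempty (Y₂ × Y₃)] :
    condEnt (C.codeLaw c) (fun ω => ω.2.1) (fun ω => ω.1) =
      ∑ i, condEnt (C.codeLaw c) (fun ω => ω.2.1 i) fun _ => () := by
  simp only [fun i => ((C.hasKernel_state c i).comp (h := fun _ => ())
    (κ := fun _ => C.Q)).condEnt_eq (C.codeLaw_nonneg c)]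
  rw [(C.hasKernel_states c).condEnt_eq (C.codeLaw_nonneg c), Finset.sum_neg_distrib,
    Finset.sum_comm]
  congr 1
  refine Finset.sum_congr rfl fun ω _ => ?_
  by_cases h0 : C.codeLaw c ω = 0
  · simp [h0]
  · rw [Real.log_prod fun i _ => C.Q_ne_zero_of_codeLaw_ne_zero c h0 i, Finset.mul_sum]

/-! ### Single-letterization and the weak converse. -/

variable [Fintype X₁] [Fintype X₂]

/-- Memorylessness: the channel kernel depends on message, states and past only through the current
state and inputs. -/
lemma condEnt_output_eq (y₀ : Y₂ × Y₃) (i : Fin n) :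
    condEnt (C.codeLaw c) (fun ω => ω.2.2 i) (fun ω => ((ω.1, ω.2.1), wordPrefix y₀ i ω.2.2)) =
      condEnt (marginal (C.codeLaw c) (c.letter i)) (fun z => z.2.2.2)
        fun z => (z.1, z.2.1, z.2.2.1) := by
  classical
  rw [condEnt_marginal, (C.hasKernel_output c y₀ i).condEnt_comp (C.codeLaw_nonneg c)
      (h := fun g => (g.1.2 i, c.enc g.1.1 i, c.relayInput i g.1.2 g.2))
      (κ := fun x => C.W x.2.1 x.2.2 x.1)]
  simp only [c.relayInput_wordPrefix, RelayCode.letter]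

lemma condEnt_output₃_eq (y₀ : Y₂ × Y₃) (i : Fin n) :
    condEnt (C.codeLaw c) (fun ω => (ω.2.2 i).2)
        (fun ω => ((ω.1, ω.2.1), wordPrefix y₀ i ω.2.2)) =
      condEnt (marginal (C.codeLaw c) (c.letter i)) (fun z => z.2.2.2.2)
        fun z => (z.1, z.2.1, z.2.2.1) := by
  classical
  rw [condEnt_marginal, ((C.hasKernel_output c y₀ i).map Prod.snd).condEnt_comp
      (C.codeLaw_nonneg c)
      (h := fun g => (g.1.2 i, c.enc g.1.1 i, c.relayInput i g.1.2 g.2))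
      (κ := fun x => marginal (C.W x.2.1 x.2.2 x.1) Prod.snd)]
  simp only [c.relayInput_wordPrefix, RelayCode.letter]

/-- Give the destination `Sⁿ` and `Y₂ⁿ`: `I(m;Y₃ⁿ) ≤ I(m;Sⁿ,Yⁿ) = I(m;Yⁿ|Sⁿ)`, then apply the chain
rule. Given `Sⁿ` and the past outputs, the relay input is determined. -/
lemma messageInfo_le_sum_broadcastInfo [Nonempty (Y₂ × Y₃)] (hM : M ≠ 0) :
    C.messageInfo c ≤ ∑ i, broadcastInfo (marginal (C.codeLaw c) (c.letter i)) := by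
  have h0 := C.codeLaw_nonneg c
  let y₀ := Classical.arbitrary (Y₂ × Y₃)
  have h1 : condEnt (C.codeLaw c) (fun ω => ω.1) (fun ω => (ω.2.1, ω.2.2)) ≤
      condEnt (C.codeLaw c) (fun ω => ω.1) (fun ω i => (ω.2.2 i).2) :=
    condEnt_le_condEnt h0 _ fun ω ω' h => by rw [(Prod.ext_iff.1 h).2]
  have h2 := C.condEnt_states_message c
  have h3 := ent_chain (C.codeLaw c) (fun ω => ω.2.1) (fun ω => ω.2.2) y₀
  have h4 := ent_chain (C.codeLaw c) (fun ω => (ω.1, ω.2.1)) (fun ω => ω.2.2) y₀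
  have h5 : ∀ i, condEnt (C.codeLaw c) (fun ω => ω.2.2 i)
      (fun ω => (ω.2.1, wordPrefix y₀ i ω.2.2)) ≤
      condEnt (marginal (C.codeLaw c) (c.letter i)) (fun z => z.2.2.2)
        fun z => (z.1, z.2.2.1) := by
    intro i
    rw [condEnt_marginal]
    refine condEnt_le_condEnt h0 _ fun ω ω' h => ?_
    simp only [Prod.mk.injEq, wordPrefix_eq_iff] at h
    simp only [RelayCode.letter, Prod.mk.injEq]
    rw [h.1, c.relayInput_congr i _ h.2]
    exact ⟨rfl, rfl⟩
  have e : ∀ i, broadcastInfo (marginal (C.codeLaw c) (c.letter i)) = _ := fun i =>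
    broadcastInfo_eq (C.isOuterLaw_letter c hM i).nonneg
  simp only [e, Finset.sum_sub_distrib, ← C.condEnt_output_eq c y₀]
  rw [← h4]
  have h6 := (Finset.sum_le_sum fun i (_ : i ∈ Finset.univ) => h5 i)
  rw [← h3] at h6
  have h7 := C.ent_codeLaw_unit c hM
  unfold messageInfo
  simp only [condEnt] at h1 h2 h6 ⊢
  rw [ent_congr (C.codeLaw c) (f := fun ω => (ω.2.1, ())) (g := fun ω => ω.2.1) (by simp),
    ent_congr (C.codeLaw c) (f := fun ω => (ω.2.1, ω.1)) (g := fun ω => (ω.1, ω.2.1))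
      fun ω ω' => by simp only [Prod.mk.injEq]; tauto] at h2
  rw [ent_congr (C.codeLaw c) (f := fun ω => (ω.1, ω.2.1, ω.2.2))
    (g := fun ω => ((ω.1, ω.2.1), ω.2.2)) fun ω ω' => by simp only [Prod.mk.injEq]; tauto] at h1
  linarith

lemma messageInfo_le_sum_accessInfo_sub [Nonempty (Y₂ × Y₃)] (hM : M ≠ 0) :
    C.messageInfo c ≤ ∑ i, (accessInfo (marginal (C.codeLaw c) (c.letter i)) -
      penaltyInfo (marginal (C.codeLaw c) (c.letter i))) := by
  set P := C.codeLaw c with hPdef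
  have h0 : 0 ≤ P := C.codeLaw_nonneg c
  let y₀ := Classical.arbitrary (Y₂ × Y₃)
  obtain ⟨s₀⟩ : Nonempty S := not_isEmpty_iff.1 fun h => by simpa using C.sum_Q
  have hS := C.condEnt_states_message_eq_sum c
  have c1 := ent_chain P (fun _ => ()) (fun ω i => (ω.2.2 i).2) y₀.2
  have c2 := ent_chain P (fun ω => (ω.1, ω.2.1)) (fun ω i => (ω.2.2 i).2) y₀.2
  have c3 := ent_chain P (fun ω => (ω.1, fun i => (ω.2.2 i).2)) (fun ω => ω.2.1) s₀
  have b1 := Finset.sum_le_sum fun i (_ : i ∈ Finset.univ) =>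
    condEnt_le_condEnt h0 (fun ω => (ω.2.2 i).2)
      (G := fun ω => ((), wordPrefix y₀.2 i fun i => (ω.2.2 i).2)) (H := fun _ => ())
      fun _ _ _ => rfl
  -- The past `Y₂` must be added to the conditioning: the relay input is not a function of the past
  -- `Y₃` and `Sⁿ` alone. This term enters negatively, so the inequality has the right direction.
  have b2 := Finset.sum_le_sum fun i (_ : i ∈ Finset.univ) =>
    condEnt_le_condEnt h0 (fun ω => (ω.2.2 i).2)
      (G := fun ω => ((ω.1, ω.2.1), wordPrefix y₀ i ω.2.2))
      (H := fun ω => ((ω.1, ω.2.1), wordPrefix y₀.2 i fun i => (ω.2.2 i).2))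
      fun ω ω' h => by
        simp only [Prod.mk.injEq, wordPrefix_eq_iff] at h ⊢
        exact ⟨h.1, fun j hj => by rw [h.2 j hj]⟩
  have b3 := Finset.sum_le_sum fun i (_ : i ∈ Finset.univ) =>
    condEnt_le_condEnt h0 (fun ω => ω.2.1 i)
      (G := fun ω => ((ω.1, fun i => (ω.2.2 i).2), wordPrefix s₀ i ω.2.1))
      (H := fun ω => (c.enc ω.1 i, (ω.2.2 i).2))
      fun ω ω' h => by
        simp only [Prod.mk.injEq, funext_iff] at h ⊢
        exact ⟨by rw [h.1.1], h.1.2 i⟩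
  have e : ∀ i, accessInfo (marginal P (c.letter i)) - penaltyInfo (marginal P (c.letter i)) =
      condEnt P (fun ω => (ω.2.2 i).2) (fun _ => ()) -
        condEnt P (fun ω => (ω.2.2 i).2) (fun ω => ((ω.1, ω.2.1), wordPrefix y₀ i ω.2.2)) +
        condEnt P (fun ω => ω.2.1 i) (fun ω => (c.enc ω.1 i, (ω.2.2 i).2)) -
        condEnt P (fun ω => ω.2.1 i) fun _ => () := fun i => by
    rw [accessInfo_sub_penaltyInfo_eq (C.isOuterLaw_letter c hM i).nonneg,
      ← C.condEnt_output₃_eq c y₀]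
    simp only [condEnt_marginal, RelayCode.letter, ← hPdef]
  have hu := C.ent_codeLaw_unit c hM
  rw [← c1] at b1
  rw [← c2] at b2
  rw [← c3] at b3
  simp only [e, Finset.sum_sub_distrib, Finset.sum_add_distrib]
  rw [← hPdef] at hS hu
  rw [← hS]
  have r1 : ent P (fun ω => ((), fun i => (ω.2.2 i).2)) = ent P fun ω i => (ω.2.2 i).2 :=
    ent_congr P (by simp)
  have r2 : ent P (fun ω => ((ω.1, fun i => (ω.2.2 i).2), ω.2.1)) =
      ent P fun ω => ((ω.1, ω.2.1), fun i => (ω.2.2 i).2) :=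
    ent_congr P fun ω ω' => by simp only [Prod.mk.injEq]; tauto
  have r3 : condEnt P (fun ω => ω.2.1) (fun ω => ω.1) =
      ent P (fun ω => (ω.1, ω.2.1)) - ent P fun ω => ω.1 := by
    unfold condEnt
    congr 1
    exact ent_congr P fun ω ω' => by simp only [Prod.mk.injEq]; tauto
  have r4 : C.messageInfo c = ent P (fun ω => ω.1) -
      (ent P (fun ω => (ω.1, fun i => (ω.2.2 i).2)) - ent P fun ω i => (ω.2.2 i).2) := rfl
  rw [r1, hu] at b1
  rw [r2] at b3
  rw [r3, r4]
  linarith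

/-- The weak converse for a single code. -/
lemma log_le_mul_Rout [Nonempty X₁] [Nonempty X₂] (hM : M ≠ 0) (hn : n ≠ 0) :
    (1 - C.errorProb c) * Real.log M ≤ n * C.Rout + Real.log 2 := by
  obtain ⟨s⟩ : Nonempty S := not_isEmpty_iff.1 fun h => by simpa using C.sum_Q
  have : Nonempty (Y₂ × Y₃) := not_isEmpty_iff.1 fun h => by
    simpa using C.sum_W (Classical.arbitrary X₁) (Classical.arbitrary X₂) s
  have : Nonempty (Fin n) := ⟨⟨0, Nat.pos_of_ne_zero hn⟩⟩
  have hn' : (0 : ℝ) < n := by positivity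
  have hL := fun i => C.isOuterLaw_letter c hM i
  have h1 := average_broadcastInfo_le hL
  have h2 := average_accessInfo_sub_penaltyInfo_le hL
  rw [Fintype.card_fin, inv_mul_le_iff₀ hn'] at h1 h2
  -- The letter laws averaged over time form a single competitor in the maximum.
  have h3 := C.isGreatest_Rout.2 ⟨_, (IsOuterLaw.average hL).mem_outerMeasures, rfl⟩
  have h4 := mul_le_mul_of_nonneg_left h3 hn'.le
  rw [mul_min_of_nonneg _ _ hn'.le] at h4
  have h5 := (le_min ((C.messageInfo_le_sum_broadcastInfo c hM).trans h1)
    ((C.messageInfo_le_sum_accessInfo_sub c hM).trans h2)).trans h4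
  linarith [C.log_le_messageInfo c hM]

lemma Achievable.le_Rout [Nonempty X₁] [Nonempty X₂] {R : ℝ} (h : C.Achievable R) :
    R ≤ C.Rout := by
  obtain ⟨M, c, hM, hc⟩ := h
  have hlim : Filter.Tendsto (fun n : ℕ => (1 - C.errorProb (c n)) * R) Filter.atTop
      (nhds ((1 - 0) * R)) := (hc.const_sub 1).mul_const R
  have hlim' : Filter.Tendsto (fun n : ℕ => C.Rout + Real.log 2 / n) Filter.atTop
      (nhds (C.Rout + 0)) := (tendsto_const_div_atTop_nhds_zero_nat _).const_add _
  rw [sub_zero, one_mul] at hlim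
  rw [add_zero] at hlim'
  refine le_of_tendsto_of_tendsto hlim hlim' ?_
  -- Error below `1` keeps the factor `1 - errorProb` nonnegative, so that `n R ≤ log M` may be
  -- multiplied by it.
  filter_upwards [hc.eventually (gt_mem_nhds one_pos), Filter.eventually_ne_atTop 0] with n he hn
  have hMpos : (0 : ℝ) < M n := (Real.exp_pos _).trans_le (hM n)
  have hn' : (0 : ℝ) < n := by positivity
  have h1 := C.log_le_mul_Rout (c n) (by exact_mod_cast hMpos.ne') hn
  have h2 : n * R ≤ Real.log (M n) := (Real.le_log_iff_exp_le hMpos).2 (hM n)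
  have h3 := mul_le_mul_of_nonneg_left h2 (sub_nonneg.2 he.le)
  rw [← mul_le_mul_iff_right₀ hn', mul_add, mul_div_cancel₀ _ hn'.ne']
  linarith

lemma capacity_le_Rout [Nonempty X₁] [Nonempty X₂] : C.capacity ≤ (C.Rout : EReal) :=
  iSup₂_le fun _ h => EReal.coe_le_coe_iff.2 (Achievable.le_Rout C h)

end RelayChannel

/-! ### A binary channel with a strict gap. -/

namespace RelayChannel

/-- The binary channel with uniform state, `Y₂ = X₁` and `Y₃ = X₁ + S`. -/
noncomputable def xorChannel : RelayChannel Bool Bool Bool Bool Bool where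
  Q _ := 1 / 2
  Q_mem := ⟨fun _ => by norm_num, by norm_num⟩
  W x₁ _ s := Pi.single (x₁, xor x₁ s) 1
  W_mem _ _ _ := single_mem_stdSimplex ℝ _

lemma sum_mul_log_eq {Ω : Type*} [Fintype Ω] {P κ : Ω → ℝ} {c : ℝ}
    (h : ∀ ω, P ω ≠ 0 → κ ω = c) : ∑ ω, P ω * Real.log (κ ω) = (∑ ω, P ω) * Real.log c := by
  rw [Finset.sum_mul]
  refine Finset.sum_congr rfl fun ω _ => ?_
  by_cases h0 : P ω = 0
  · simp [h0]
  · rw [h ω h0]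

lemma eq_of_mem_xorChannel {P : Bool × Bool × Bool × Bool × Bool → ℝ}
    (hP : P ∈ xorChannel.trivMeasures) {z : Bool × Bool × Bool × Bool × Bool} (hz : P z ≠ 0) :
    z.2.2.2 = (z.2.1, xor z.2.1 z.1) := by
  obtain ⟨p₁, p₂, -, -, rfl⟩ := hP
  by_contra h
  exact hz (by simp [xorChannel, h])

lemma accessInfo_sub_penaltyInfo_xorChannel {P : Bool × Bool × Bool × Bool × Bool → ℝ}
    (hP : P ∈ xorChannel.outerMeasures) : accessInfo P - penaltyInfo P ≤ 0 := by
  have hPt := xorChannel.outerMeasures_subset_trivMeasures hP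
  have hP0 := xorChannel.nonneg_of_mem_trivMeasures hPt
  have hS : HasKernel P (fun z => z.1) (fun _ => ()) fun _ _ => 1 / 2 := by
    have hm : ∀ s, marginal P (fun z => (z.1, ())) (s, ()) = 1 / 2 := fun s => by
      rw [marginal_congr P (g := fun z => z.1) (b := s) (by simp),
        marginal_state_of_mem_trivMeasures _ hPt]
      rfl
    intro _ s
    rw [hm, ← sum_marginal_prodMk P fun z => z.1]
    simp only [hm]
    norm_num
  have h1 := condEnt_le_cross hP0 (fun z => z.2.2.2.2) (fun _ => ()) (fun _ _ => 1 / 2)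
    (by norm_num) (by norm_num) (by norm_num)
  have h2 := condEnt_nonneg hP0 (fun z => z.2.2.2.2) (fun z => (z.1, z.2.1, z.2.2.1))
  -- `S = X₁ + Y₃` on the support, so the deterministic test kernel forces `H(S|X₁,Y₃) ≤ 0`.
  have h3 := condEnt_le_cross hP0 (fun z => z.1) (fun z => (z.2.1, z.2.2.2.2))
    (fun g s => if s = xor g.1 g.2 then 1 else 0) (fun _ _ => by split_ifs <;> norm_num)
    (by simp) (fun z hz => by rw [eq_of_mem_xorChannel hPt hz]; simp)
  rw [sum_mul_log_eq (c := 1) fun z hz => by rw [eq_of_mem_xorChannel hPt hz]; simp] at h3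
  rw [accessInfo_sub_penaltyInfo_eq hP0, hS.condEnt_eq hP0]
  simp only [Real.log_one, mul_zero, neg_zero] at h3
  linarith

/-- The law of `(S, X₁, X₂, Y₂, Y₃)` for independent uniform inputs. -/
noncomputable def xorUniform : Bool × Bool × Bool × Bool × Bool → ℝ :=
  fun (s, x₁, x₂, y) => xorChannel.Q s * (1 / 2) * (1 / 2) * xorChannel.W x₁ x₂ s y

/-- The witness has `X₁` independent of `S`, so the gap is due to the penalty term and not to the
larger set of laws. -/
lemma xorUniform_mem : xorUniform ∈ xorChannel.trivMeasures :=
  ⟨fun _ _ => 1 / 2, fun _ _ _ => 1 / 2, fun _ => ⟨fun _ => by norm_num, by norm_num⟩,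
    fun _ _ => ⟨fun _ => by norm_num, by norm_num⟩, rfl⟩

lemma xorUniform_nonneg : 0 ≤ xorUniform := xorChannel.nonneg_of_mem_trivMeasures xorUniform_mem

lemma sum_xorUniform : ∑ z, xorUniform z = 1 := by
  simp [Fintype.sum_prod_type, xorUniform, xorChannel, Pi.single_apply]
  norm_num

/-- Given `(S,X₂)` the output pair is a bijective image of the uniform bit `X₁`, and given `X₁` as
well it is deterministic. -/
lemma log_two_le_broadcastInfo_xorUniform : Real.log 2 ≤ broadcastInfo xorUniform := by
  have hk : HasKernel xorUniform (fun z => z.2.2.2) (fun z => (z.1, z.2.2.1))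
      fun g y => if y.2 = xor y.1 g.1 then 1 / 2 else 0 := by
    rintro ⟨s, x₂⟩ ⟨y₂, y₃⟩
    cases s <;> cases x₂ <;> cases y₂ <;> cases y₃ <;>
    simp [marginal_eq_sum_ite, Fintype.sum_prod_type, xorUniform, xorChannel, Pi.single_apply] <;>
    norm_num
  have h1 := condEnt_le_cross xorUniform_nonneg (fun z => z.2.2.2)
    (fun z => (z.1, z.2.1, z.2.2.1)) (fun g => xorChannel.W g.2.1 g.2.2 g.1)
    (fun g => xorChannel.W_nonneg _ _ _) (fun g => (xorChannel.sum_W _ _ _).le)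
    (fun z hz => by rw [eq_of_mem_xorChannel xorUniform_mem hz]; simp [xorChannel])
  rw [sum_mul_log_eq (c := 1) fun z hz => by
    rw [eq_of_mem_xorChannel xorUniform_mem hz]; simp [xorChannel]] at h1
  rw [broadcastInfo_eq xorUniform_nonneg, hk.condEnt_eq xorUniform_nonneg,
    sum_mul_log_eq (c := 1 / 2) fun z hz => by
      rw [eq_of_mem_xorChannel xorUniform_mem hz]; simp, sum_xorUniform]
  simp only [Real.log_one, mul_zero, neg_zero, one_div, Real.log_inv] at h1 ⊢
  linarith

lemma log_two_le_accessInfo_xorUniform : Real.log 2 ≤ accessInfo xorUniform := by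
  have hk : HasKernel xorUniform (fun z => z.2.2.2.2) (fun z => z.1) fun _ _ => 1 / 2 := by
    rintro s y₃
    cases s <;> cases y₃ <;>
    simp [marginal_eq_sum_ite, Fintype.sum_prod_type, xorUniform, xorChannel, Pi.single_apply] <;>
    norm_num
  have h1 := condEnt_le_cross xorUniform_nonneg (fun z => z.2.2.2.2)
    (fun z => (z.1, z.2.1, z.2.2.1)) (fun g => Pi.single (xor g.2.1 g.1) 1)
    (fun g => (single_mem_stdSimplex ℝ _).1) (fun g => (single_mem_stdSimplex ℝ _).2.le)
    (fun z hz => by rw [eq_of_mem_xorChannel xorUniform_mem hz]; simp)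
  rw [sum_mul_log_eq (c := 1) fun z hz => by
    rw [eq_of_mem_xorChannel xorUniform_mem hz]; simp] at h1
  rw [accessInfo_eq xorUniform_nonneg, hk.condEnt_eq xorUniform_nonneg, ← Finset.sum_mul,
    sum_xorUniform]
  simp only [Real.log_one, mul_zero, neg_zero, one_div, Real.log_inv] at h1 ⊢
  linarith

lemma Rout_xorChannel_lt_Rtriv : xorChannel.Rout < xorChannel.Rtriv := by
  obtain ⟨P, hP, hPR⟩ := xorChannel.isGreatest_Rout.1
  calc xorChannel.Rout ≤ 0 :=
        hPR ▸ (min_le_right _ _).trans (accessInfo_sub_penaltyInfo_xorChannel hP)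
    _ < Real.log 2 := Real.log_pos (by norm_num)
    _ ≤ min (broadcastInfo xorUniform) (accessInfo xorUniform) :=
        le_min log_two_le_broadcastInfo_xorUniform log_two_le_accessInfo_xorUniform
    _ ≤ xorChannel.Rtriv := xorChannel.isGreatest_Rtriv.2 ⟨xorUniform, xorUniform_mem, rfl⟩

end RelayChannel

theorem theorem2 {X₁ X₂ S Y₂ Y₃ : Type*} [Fintype X₁] [Fintype X₂] [Fintype S] [Fintype Y₂]
    [Fintype Y₃] [Nonempty X₁] [Nonempty X₂] (C : RelayChannel X₁ X₂ S Y₂ Y₃) :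
    -- both suprema are maxima
    IsGreatest C.outerValues C.Rout ∧ IsGreatest C.trivValues C.Rtriv ∧
    -- the upper bound on the capacity
    C.capacity ≤ (C.Rout : EReal) ∧
    -- it is never worse than the trivial bound, and for some channel it is strictly better
    C.Rout ≤ C.Rtriv ∧
    ∃ C' : RelayChannel Bool Bool Bool Bool Bool, C'.Rout < C'.Rtriv := by
  exact ⟨C.isGreatest_Rout, C.isGreatest_Rtriv, C.capacity_le_Rout, C.Rout_le_Rtriv,
    RelayChannel.xorChannel, RelayChannel.Rout_xorChannel_lt_Rtriv⟩
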